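/- All functions live on $\mathbb R^2$; $\hat f(\xi)=\int e^{-2\pi i x\cdot\xi}f(x)\,dx$, $\Lambda^\sigma$ is the Fourier multiplier with symbol $|\xi|^\sigma$, and for $w:[0,\infty)\to\mathbb R$ the operator $w(D)$ has symbol $w(|\xi|)$. **Notation.** Let $\mathcal A_j=\{2^{j-1}<|\xi|<2^{j+1}\}$ for $j\in\mathbb Z$. Let $\phi\ge 0$ be a radial Schwartz function with $\operatorname{supp}\phi\subset\mathcal A_0$ and $\sum_{j\in\mathbb Z}\phi(2^{-j}\xi)=1$ for $\xi\ne0$, and let $\triangle_j$ be the multiplier with symbol $\phi(2^{-j}\xi)$. For a weight $w$ and $\sigma\in\mathbb R$ put $\|u\|_{\dot H^\sigma_w}=\big\||\xi|^\sigma w(|\xi|)\hat u\big\|_{L^2}$ and $\|u\|_{H^\sigma_w}=\big\|(1+|\xi|^2)^{\sigma/2} w(|\xi|)\hat u\big\|_{L^2}$. $\mathscr M_W$ is the set of quotients $\omega_a/\omega_b$, where $\omega_a,\omega_b\in C^1([0,\infty))$ are positive and nondecreasing and each satisfies, for some constant, $y\,\omega'(y)\le C\omega(y)$ and $\omega(yz)\le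 C(\omega(y)+\omega(z))$ for all $y,z\ge0$. Let $m$ be such that $1+m\in\mathscr M_W$, and let $\nu\in C^1([0,\infty))$ be such that $\nu,\nu'\ge0$, $y\nu'(y)\le C$ and $\nu(y)\le C(1+m(y))$ for all $y\ge 0$, for some constant $C$. For $\lambda\ge0$ let $E^\lambda_\nu=e^{\lambda\nu(D)}$. For $\sigma\le1$ and $\tau\in\mathbb R$ let $$\pi^{\sigma,\tau}_{\varrho,\tilde\varrho}(u,v)=\begin{cases}\|u\|_{\dot H^\sigma_\varrho}\|v\|_{\dot H^\tau_{\tilde\varrho}},&\sigma<1,\\ \|u\|_{H^1_\varrho}\|v\|_{\dot H^\tau_{\tilde\varrho}},&\sigma=1,\end{cases}\qquad \rho^{\sigma,\tau}_{\varrho,\tilde\varrho}(u,v)=\|u\|_{\dot H^\sigma_\varrho}\|v\|_{\dot H^\tau_{\tilde\varrho}},$$ and for $y\ge0$ and a weight $w$ let $$I_{\sigma,w}(y)=\int_0^1\frac{t^{1-2\sigma}}{w(yt)^2}\,dt\ \ (\sigma<1),\qquad I_{1,w}(y)=\int_0^y\frac{t}{(1+t^2)\,w(t)^2}\,dt .$$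 **Statement.** Let $r,s,\bar s\in\mathbb R$ with $s,\bar s\le1$ and $s+\bar s>0$. Let $\omega,\omega_\ell,\tilde\omega_\ell\in\mathscr M_W$ and $\Gamma_\ell:[0,\infty)\to[0,\infty)$, $\ell=1,2,3$, be such that for some constants $C_1,C_2,C_3>0$ and all $y\ge0$ $$\frac{\omega(y)}{\tilde\omega_1(y)}I_{s,\omega_1}(y)^{1/2}\le C_1\Gamma_1(y),\qquad \frac{\omega(y)}{\tilde\omega_2(y)}I_{\bar s,\omega_2}(y)^{1/2}\le C_2\Gamma_2(y),\qquad \frac{\omega(y)}{\omega_3(y)\tilde\omega_3(y)}\le C_3\Gamma_3(y).$$ Then there are constants $c,C>0$, depending only on $\phi$, $r,s,\bar s$, $\nu$, the weights and the $\Gamma_\ell$, with the following property. Let $\lambda\ge0$, and let $f,g$ be tempered distributions with $\hat f,\hat g\in L^1_{\rm loc}$ for which the three quantities $\pi^{s,\bar s}_{\omega_1,\tilde\omega_1}(E^\lambda_\nu f,\Lambda E^\lambda_\nu g)$, $\pi^{\bar s,s}_{\omega_2,\tilde\omega_2}(\Lambda E^\lambda_\nu g,E^\lambda_\nu f)$,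 $\rho^{s,\bar s}_{\omega_3,\tilde\omega_3}(E^\lambda_\nu f,\Lambda E^\lambda_\nu g)$ are finite (where $0\cdot\infty=0$). Then there is a nonnegative sequence $(c_j)_{j\in\mathbb Z}$ (depending on $f,g,\lambda$) with $\sum_jc_j^2\le1$ such that, for every $j\in\mathbb Z$, every $h\in L^2$ with $\hat h=0$ almost everywhere outside $\mathcal A_j$, and each of the operators $$A=\omega(D)\Lambda^rE^\lambda_\nu\triangle_j\partial_\ell\ (\ell=1,2),\qquad A=\omega(D)\Lambda^{r+1}E^\lambda_\nu\triangle_j ,$$ the pairing of $[A,g]f=A(gf)-g(Af)$ with $h$ is well defined (on the Fourier side, with products given by convolutions: the convolutions converge absolutely almost everywhere, and the pairings of $A(gf)$ and of $g(Af)$ with $h$ converge absolutely) and $$|\langle[A,g]f,h\rangle|\le C(1+\lambda)e^{c\lambda}c_j2^{(r-s-\bar s+1)j}\Big\{\Gamma_1(2^j)\,\pi^{s,\bar s}_{\omega_1,\tilde\omega_1}(E^\lambda_\nu f,\Lambda E^\lambda_\nu g)+\Gamma_2(2^j)\,\pi^{\bar s,s}_{\omega_2,\tilde\omega_2}(\Lambda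 E^\lambda_\nu g,E^\lambda_\nu f)+\Gamma_3(2^j)\,\rho^{s,\bar s}_{\omega_3,\tilde\omega_3}(E^\lambda_\nu f,\Lambda E^\lambda_\nu g)\Big\}\|h\|_{L^2}.$$ -/

import Mathlib

open MeasureTheory Set
open scoped SchwartzMap FourierTransform ENNReal

noncomputable section

/-! ### Frequency weights -/

/-- The regularity, growth and product conditions on a weight `w : [0, ∞) → (0, ∞)`.  Only the values of `w`
on `[0, ∞)` matter; the derivative at `0` is the one-sided one. -/
structure IsPhaseWeight (w : ℝ → ℝ) : Prop where
  contDiffOn : ContDiffOn ℝ 1 w (Ici 0)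
  pos : ∀ y, 0 ≤ y → 0 < w y
  deriv_nonneg : ∀ y, 0 ≤ y → 0 ≤ derivWithin w (Ici 0) y
  deriv_le : ∃ C : ℝ, 0 < C ∧ ∀ y, 0 ≤ y → y * derivWithin w (Ici 0) y ≤ C * w y
  mul_le : ∃ C : ℝ, 0 < C ∧ ∀ y z, 0 ≤ y → 0 ≤ z → w (y * z) ≤ C * (w y + w z)

/-- The class `𝓜_W` of quotients of two such weights. -/
def MemMW (w : ℝ → ℝ) : Prop :=
  ∃ wa wb : ℝ → ℝ, IsPhaseWeight wa ∧ IsPhaseWeight wb ∧ ∀ y, 0 ≤ y → w y = wa y / wb y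

/-- The class `𝓜_D` of dissipation symbols: `1 + m` belongs to `𝓜_W`. -/
def MemMD (m : ℝ → ℝ) : Prop :=
  MemMW (fun y => 1 + m y)

/-- The class `𝓜_S(m)` of smoothing symbols associated with the dissipation symbol `m`. -/
structure MemMS (m ν : ℝ → ℝ) : Prop where
  contDiffOn : ContDiffOn ℝ 1 ν (Ici 0)
  nonneg : ∀ y, 0 ≤ y → 0 ≤ ν y
  deriv_nonneg : ∀ y, 0 ≤ y → 0 ≤ derivWithin ν (Ici 0) y
  deriv_le : ∃ C : ℝ, 0 < C ∧ ∀ y, 0 ≤ y → y * derivWithin ν (Ici 0) y ≤ C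
  le_dissipation : ∃ C : ℝ, 0 < C ∧ ∀ y, 0 ≤ y → ν y ≤ C * (1 + m y)

/-! ### The conditions linking the weights and the functions `Γ` -/

/-- The low-frequency integral attached to a regularity exponent `s` and a weight
`w` in dimension two, as an element of `[0, ∞]`. -/
def lowFreqIntegral (s : ℝ) (w : ℝ → ℝ) (y : ℝ) : ℝ≥0∞ :=
  if s < 1 then
    ∫⁻ t in Ioo (0 : ℝ) 1, ENNReal.ofReal (t ^ (1 - 2 * s) / w (y * t) ^ 2)
  else
    ∫⁻ t in Ioo (0 : ℝ) y, ENNReal.ofReal (t / ((1 + t ^ 2) * w t ^ 2))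

/-- `(ω(y) / ω̃(y)) * (low-frequency integral)^(1/2) ≤ C Γ(y)` for all `y ≥ 0`. -/
def LowHighCondition (s : ℝ) (ω w w' Γ : ℝ → ℝ) : Prop :=
  ∃ C : ℝ, 0 < C ∧ ∀ y, 0 ≤ y →
    ENNReal.ofReal (ω y / w' y) * lowFreqIntegral s w y ^ (1 / 2 : ℝ) ≤ ENNReal.ofReal (C * Γ y)

/-- `ω(y) / (w(y) w'(y)) ≤ C Γ(y)` for all `y ≥ 0`. -/
def HighHighCondition (ω w w' Γ : ℝ → ℝ) : Prop :=
  ∃ C : ℝ, 0 < C ∧ ∀ y, 0 ≤ y → ω y / (w y * w' y) ≤ C * Γ y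

/-! ### Fourier side: densities, symbols and norms -/

/-- The physical and the frequency space `ℝ²`. -/
abbrev Plane : Type := EuclideanSpace ℝ (Fin 2)

/-- The Fourier transform of the tempered distribution `u` is the locally integrable function
`φ`, i.e. both agree on compactly supported test functions (this determines `𝓕 u`, and `φ`
almost everywhere). -/
def HasFourierDensity (u : 𝓢'(Plane, ℂ)) (φ : Plane → ℂ) : Prop :=
  LocallyIntegrable φ volume ∧
    ∀ ψ : 𝓢(Plane, ℂ), HasCompactSupport ψ → (𝓕 u) ψ = ∫ ξ, ψ ξ * φ ξ

/-- The open annulus of radii `2 ^ (j - 1)` and `2 ^ (j + 1)` centred at the origin. -/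
def dyadicAnnulus (j : ℤ) : Set Plane :=
  {ξ | (2 : ℝ) ^ (j - 1) < ‖ξ‖ ∧ ‖ξ‖ < (2 : ℝ) ^ (j + 1)}

/-- `φ` generates a homogeneous Littlewood--Paley decomposition: it is Schwartz, non-negative,
radial, supported in the annulus of radii `1/2` and `2`, and its dyadic dilates form a partition
of unity away from the origin. -/
structure IsLittlewoodPaley (φ : 𝓢(Plane, ℝ)) : Prop where
  nonneg : ∀ ξ, 0 ≤ φ ξ
  radial : ∀ ξ η : Plane, ‖ξ‖ = ‖η‖ → φ ξ = φ η
  support : tsupport φ ⊆ dyadicAnnulus 0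
  partition : ∀ ξ : Plane, ξ ≠ 0 → HasSum (fun j : ℤ => φ ((2 : ℝ) ^ (-j) • ξ)) 1

/-- The symbol of the radial multiplier operator `w(D)`. -/
def radialSymbol (w : ℝ → ℝ) (ξ : Plane) : ℂ := (w ‖ξ‖ : ℂ)

/-- The symbol `|ξ| ^ σ` of `Λ ^ σ`. -/
def lambdaSymbol (σ : ℝ) (ξ : Plane) : ℂ := ((‖ξ‖ ^ σ : ℝ) : ℂ)

/-- The symbol `(1 + |ξ|²) ^ (σ / 2)` of the inhomogeneous Bessel potential. -/
def besselSymbol (σ : ℝ) (ξ : Plane) : ℂ := (((1 + ‖ξ‖ ^ 2) ^ (σ / 2) : ℝ) : ℂ)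

/-- The symbol `exp (lam ν(|ξ|))` of the smoothing operator `E`. -/
def gevreySymbol (lam : ℝ) (ν : ℝ → ℝ) (ξ : Plane) : ℂ := (Real.exp (lam * ν ‖ξ‖) : ℂ)

/-- The symbol of the Littlewood--Paley block `Δ_j`. -/
def blockSymbol (φ : 𝓢(Plane, ℝ)) (j : ℤ) (ξ : Plane) : ℂ := (φ ((2 : ℝ) ^ (-j) • ξ) : ℂ)

/-- The symbol of the partial derivative `∂_ℓ`. -/
def partialSymbol (ℓ : Fin 2) (ξ : Plane) : ℂ := 2 * Real.pi * Complex.I * (ξ ℓ : ℂ)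

/-- The weighted homogeneous Sobolev norm of the distribution whose Fourier transform is `φ`. -/
def homSobolev (σ : ℝ) (w : ℝ → ℝ) (φ : Plane → ℂ) : ℝ≥0∞ :=
  eLpNorm (lambdaSymbol σ * radialSymbol w * φ) 2 volume

/-- The weighted inhomogeneous Sobolev norm of the distribution whose Fourier transform is `φ`. -/
def inhomSobolev (σ : ℝ) (w : ℝ → ℝ) (φ : Plane → ℂ) : ℝ≥0∞ :=
  eLpNorm (besselSymbol σ * radialSymbol w * φ) 2 volume

/-- The product norm `π^{σ,τ}_{w,w'}(u,v)` in dimension two, for `σ ≤ 1`; `φ` and `ψ` are the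
Fourier transforms of `u` and `v`. -/
def piNorm (σ τ : ℝ) (w w' : ℝ → ℝ) (φ ψ : Plane → ℂ) : ℝ≥0∞ :=
  (if σ < 1 then homSobolev σ w φ else inhomSobolev σ w φ) * homSobolev τ w' ψ

/-- The product norm `ρ^{σ,τ}_{w,w'}(u,v)`. -/
def rhoNorm (σ τ : ℝ) (w w' : ℝ → ℝ) (φ ψ : Plane → ℂ) : ℝ≥0∞ :=
  homSobolev σ w φ * homSobolev τ w' ψ

/-! ### Products and commutators, on the Fourier side -/

/-- The Fourier transform of the product of the distributions with Fourier transforms `φ`, `ψ`: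
the convolution of `φ` and `ψ`. -/
def productHat (φ ψ : Plane → ℂ) (ξ : Plane) : ℂ := ∫ η, φ (ξ - η) * ψ η

/-- The convolution defining `productHat φ ψ` converges absolutely at almost every frequency. -/
def ProductExists (φ ψ : Plane → ℂ) : Prop :=
  ∀ᵐ ξ ∂(volume : Measure Plane), Integrable (fun η => φ (ξ - η) * ψ η) volume

/-- The `L²` pairing `⟨u, h⟩ = ∫ u h̄` of the distribution with Fourier transform `φ` with `h`,
written on the Fourier side by means of Parseval's identity. -/
def fourierPairing (φ : Plane → ℂ) (h : Lp ℂ 2 (volume : Measure Plane)) : ℂ :=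
  ∫ ξ, φ ξ * (starRingEnd ℂ) ((𝓕 h : Lp ℂ 2 (volume : Measure Plane)) ξ)

/-- The pairing of the distribution with Fourier transform `φ` with `h` converges absolutely. -/
def PairingExists (φ : Plane → ℂ) (h : Lp ℂ 2 (volume : Measure Plane)) : Prop :=
  Integrable (fun ξ => φ ξ * (starRingEnd ℂ) ((𝓕 h : Lp ℂ 2 (volume : Measure Plane)) ξ)) volume

/-- The Fourier transform of `[A, g] f = A (g f) - g (A f)`, where `A` is the Fourier multiplier
with symbol `a`, and `φ`, `ψ` are the Fourier transforms of `f`, `g`. -/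
def commutatorHat (a ψ φ : Plane → ℂ) : Plane → ℂ :=
  a * productHat φ ψ - productHat (a * φ) ψ

/-- The pairing `⟨[A, g] f, h⟩` makes sense: the products `g f` and `g (A f)` exist, and so do the
pairings of `A (g f)` and of `g (A f)` with `h`. -/
def CommutatorPairingExists (a ψ φ : Plane → ℂ) (h : Lp ℂ 2 (volume : Measure Plane)) : Prop :=
  ProductExists φ ψ ∧ ProductExists (a * φ) ψ ∧
    PairingExists (a * productHat φ ψ) h ∧ PairingExists (productHat (a * φ) ψ) h

/-- The Fourier transform of `h ∈ L²` is supported in the annulus of index `j`. -/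
def SpectrallyLocalized (h : Lp ℂ 2 (volume : Measure Plane)) (j : ℤ) : Prop :=
  ∀ᵐ ξ ∂(volume : Measure Plane),
    ξ ∉ dyadicAnnulus j → (𝓕 h : Lp ℂ 2 (volume : Measure Plane)) ξ = 0

end

/-!
Let `u` and `v` be the absolute values of the Fourier transforms of `E f` and `Λ E g`. On the Fourier
side the commutator is the integral of `(a(ξ) - a(ζ)) f̂(ζ) ĝ(η)` over `ξ = ζ + η`, and the whole
commutator gain is contained in the pointwise bound
`|a(ξ) - a(ζ)| |f̂(ζ)| |ĝ(η)| ≤ C (1 + λ) exp(c λ) ω(2 ^ j) 2 ^ (r j) u(ζ) v(η)` for `ξ` in the annulus of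
index `j` (`norm_dyadicSymbol_sub_le`). If `|η|` is small compared to `2 ^ j`, it is the Lipschitz
estimate for `a`; otherwise the factor `|η| ≳ 2 ^ j` contained in `v` makes up for the size of `a`, and
the exponentials are distributed by means of `ν(|ξ|) ≤ ν(|ζ|) + ν(|η|) + C`. All the weights enter
through one property: `log w` is a Lipschitz function of `log y` (`IsLogLipschitz`).

It remains to bound the positive trilinear form `∫∫ u(ξ - η) v(η) |ĥ(ξ)| dη dξ`
(`exists_trilinear_le`), by three instances of Young's inequality. If `|ζ|` is small compared to
`2 ^ j`, then `u` is put in `L¹` by Cauchy–Schwarz against its weight; in polar coordinates the dual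
norm of the weight is the low-frequency integral (`lintegral_ball_le_lowNorm`). Small `|η|` is
symmetric. If both frequencies are at least of order `2 ^ j`, then they are comparable, `ĥ` is put in
`L¹`, and half of the decay `(2 ^ j / |η|) ^ (s + s')` pays for the change of the weights between the
frequencies `2 ^ j` and `|η|`: the product condition `w(y z) ≤ C (w(y) + w(z))` makes the weights grow
slower than every power (`IsPhaseWeight.exists_le_rpow`). In all three cases the remaining factor is
the `L²` norm of a density multiplied by `(2 ^ j / |η|) ^ δ` on `|η| ≥ 2 ^ j / 4`, with
`δ = (s + s') / 2`. These norms are square summable in `j` (`exists_tsum_tailWeight_sq_le`), and their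
normalized sum is the sequence `c_j`.

The same bound gives the absolute convergence of the products, except for the low frequencies of
`g`, where the gain `|η|` is lost and the local integrability of `ĝ` is used instead
(`trilinear_ne_top_of_locallyIntegrable`).
-/

/-! ### Log-Lipschitz weights -/

/-- A function that is positive on `(0, ∞)` and whose logarithm is `K`-Lipschitz as a function of the
logarithm of the variable. Equivalently, `|t q'(t)| ≤ K q(t)` in the differentiable case. -/
def IsLogLipschitz (K : ℝ) (q : ℝ → ℝ) : Prop :=
  (∀ t, 0 < t → 0 < q t) ∧
    ∀ t u, 0 < t → 0 < u → |Real.log (q t) - Real.log (q u)| ≤ K * |Real.log t - Real.log u|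

namespace IsLogLipschitz

variable {K K' : ℝ} {p q : ℝ → ℝ}

lemma nonneg (h : IsLogLipschitz K q) : 0 ≤ K := by
  have := h.2 (Real.exp 1) 1 (Real.exp_pos 1) one_pos
  simp only [Real.log_exp, Real.log_one, sub_zero, abs_one, mul_one] at this
  exact (abs_nonneg _).trans this

lemma mul (h : IsLogLipschitz K p) (h' : IsLogLipschitz K' q) :
    IsLogLipschitz (K + K') (fun t => p t * q t) := by
  refine ⟨fun t ht => mul_pos (h.1 t ht) (h'.1 t ht), fun t u ht hu => ?_⟩
  rw [Real.log_mul (h.1 t ht).ne' (h'.1 t ht).ne', Real.log_mul (h.1 u hu).ne' (h'.1 u hu).ne']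
  calc _ = |(Real.log (p t) - Real.log (p u)) + (Real.log (q t) - Real.log (q u))| := by
        congr 1; ring
    _ ≤ _ := abs_add_le _ _
    _ ≤ _ := by rw [add_mul]; exact add_le_add (h.2 t u ht hu) (h'.2 t u ht hu)

lemma inv (h : IsLogLipschitz K q) : IsLogLipschitz K (fun t => (q t)⁻¹) := by
  refine ⟨fun t ht => inv_pos.2 (h.1 t ht), fun t u ht hu => ?_⟩
  rw [Real.log_inv, Real.log_inv, neg_sub_neg, abs_sub_comm]
  exact h.2 t u ht hu

lemma rpow (r : ℝ) : IsLogLipschitz |r| (fun t => t ^ r) := by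
  refine ⟨fun t ht => Real.rpow_pos_of_pos ht r, fun t u ht hu => ?_⟩
  rw [Real.log_rpow ht, Real.log_rpow hu, ← mul_sub, abs_mul]

lemma exp {f : ℝ → ℝ} (hf : ∀ t u, 0 < t → 0 < u → |f t - f u| ≤ K * |Real.log t - Real.log u|)
    {lam : ℝ} (hlam : 0 ≤ lam) : IsLogLipschitz (lam * K) (fun t => Real.exp (lam * f t)) := by
  refine ⟨fun t _ => Real.exp_pos _, fun t u ht hu => ?_⟩
  rw [Real.log_exp, Real.log_exp, ← mul_sub, abs_mul, abs_of_nonneg hlam, mul_assoc]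
  exact mul_le_mul_of_nonneg_left (hf t u ht hu) hlam

lemma congr (h : IsLogLipschitz K p) (hpq : ∀ t, 0 < t → q t = p t) : IsLogLipschitz K q := by
  refine ⟨fun t ht => hpq t ht ▸ h.1 t ht, fun t u ht hu => ?_⟩
  rw [hpq t ht, hpq u hu]
  exact h.2 t u ht hu

/-- A log-Lipschitz function varies by at most the factor `R ^ K` between comparable points. -/
lemma le_rpow_mul (h : IsLogLipschitz K q) {R t u : ℝ} (ht : 0 < t) (hu : 0 < u) (hR : 0 < R)
    (htu : t ≤ R * u) (hut : u ≤ R * t) : q t ≤ R ^ K * q u := by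
  rw [← Real.log_le_log_iff (h.1 t ht) (mul_pos (Real.rpow_pos_of_pos hR K) (h.1 u hu)),
    Real.log_mul (Real.rpow_pos_of_pos hR K).ne' (h.1 u hu).ne', Real.log_rpow hR]
  have h1 := (abs_le.1 (h.2 t u ht hu)).2
  have h2 : |Real.log t - Real.log u| ≤ Real.log R := by
    have e1 := Real.log_le_log ht htu
    have e2 := Real.log_le_log hu hut
    rw [Real.log_mul hR.ne' hu.ne'] at e1
    rw [Real.log_mul hR.ne' ht.ne'] at e2
    rw [abs_le]; constructor <;> linarith
  nlinarith [mul_le_mul_of_nonneg_left h2 h.nonneg]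

lemma abs_sub_le (h : IsLogLipschitz K q) {R t u : ℝ} (ht : 0 < t) (hu : 0 < u) (hR : 0 < R)
    (htu : t ≤ R * u) (hut : u ≤ R * t) :
    |q t - q u| ≤ q u * (R ^ K * K) * |Real.log t - Real.log u| := by
  have key : ∀ t u, 0 < t → 0 < u → q t - q u ≤ q t * (K * |Real.log t - Real.log u|) := by
    intro t u ht hu
    have h1 := Real.add_one_le_exp (Real.log (q u) - Real.log (q t))
    rw [Real.exp_sub, Real.exp_log (h.1 u hu), Real.exp_log (h.1 t ht), le_div_iff₀ (h.1 t ht)] at h1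
    have h2 := (abs_le.1 (h.2 t u ht hu)).2
    have := mul_le_mul_of_nonneg_left h2 (h.1 t ht).le
    nlinarith
  have hRK := h.le_rpow_mul ht hu hR htu hut
  have hR1 : 1 ≤ R ^ K := by
    refine Real.one_le_rpow ?_ h.nonneg
    nlinarith
  have hx : 0 ≤ K * |Real.log t - Real.log u| := mul_nonneg h.nonneg (abs_nonneg _)
  rw [abs_le]
  constructor
  · have := key u t hu ht
    rw [abs_sub_comm] at this
    have h3 : q u * (K * |Real.log t - Real.log u|) ≤
        q u * R ^ K * (K * |Real.log t - Real.log u|) :=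
      mul_le_mul_of_nonneg_right (le_mul_of_one_le_right (h.1 u hu).le hR1) hx
    nlinarith
  · have := key t u ht hu
    have h3 := mul_le_mul_of_nonneg_right hRK hx
    nlinarith

end IsLogLipschitz

lemma abs_log_sub_log_le {a t u : ℝ} (ha : 0 < a) (ht : a ≤ t) (hu : a ≤ u) :
    |Real.log t - Real.log u| ≤ |t - u| / a := by
  have key : ∀ t u, a ≤ t → a ≤ u → Real.log t - Real.log u ≤ |t - u| / a := by
    intro t u ht hu
    have hu0 : 0 < u := ha.trans_le hu
    have ht0 : 0 < t := ha.trans_le ht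
    have h1 := Real.log_le_sub_one_of_pos (div_pos ht0 hu0)
    rw [Real.log_div ht0.ne' hu0.ne'] at h1
    calc _ ≤ (t - u) / u := by rw [sub_div, div_self hu0.ne']; exact h1
      _ ≤ |t - u| / u := by gcongr; exact le_abs_self _
      _ ≤ _ := by gcongr
  rw [abs_le]
  refine ⟨?_, key t u ht hu⟩
  have := key u t hu ht
  rw [abs_sub_comm] at this
  linarith

/-- A nondecreasing function with `y f'(y) ≤ C` grows at most logarithmically. -/
lemma monotoneOn_and_abs_sub_le_log {f f' : ℝ → ℝ} {C : ℝ}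
    (hf : ∀ y, 0 < y → HasDerivAt f (f' y) y) (h0 : ∀ y, 0 < y → 0 ≤ f' y)
    (hC : ∀ y, 0 < y → y * f' y ≤ C) :
    MonotoneOn f (Ioi 0) ∧
      ∀ t u, 0 < t → 0 < u → |f t - f u| ≤ C * |Real.log t - Real.log u| := by
  have hm : MonotoneOn f (Ioi 0) := by
    refine monotoneOn_of_deriv_nonneg (convex_Ioi 0)
      (fun y hy => (hf y hy).continuousAt.continuousWithinAt) ?_ ?_
    · rw [interior_Ioi]
      exact fun y hy => (hf y hy).differentiableAt.differentiableWithinAt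
    · rw [interior_Ioi]
      intro y hy
      rw [(hf y hy).deriv]
      exact h0 y hy
  have hg : ∀ y, 0 < y → HasDerivAt (fun y => C * Real.log y - f y) (C * y⁻¹ - f' y) y :=
    fun y hy => ((Real.hasDerivAt_log hy.ne').const_mul C).sub (hf y hy)
  have hm' : MonotoneOn (fun y => C * Real.log y - f y) (Ioi 0) := by
    refine monotoneOn_of_deriv_nonneg (convex_Ioi 0)
      (fun y hy => (hg y hy).continuousAt.continuousWithinAt) ?_ ?_
    · rw [interior_Ioi]
      exact fun y hy => (hg y hy).differentiableAt.differentiableWithinAt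
    · rw [interior_Ioi]
      intro y hy
      have hy : 0 < y := hy
      rw [(hg y hy).deriv, sub_nonneg, ← div_eq_mul_inv, le_div_iff₀ hy, mul_comm]
      exact hC y hy
  refine ⟨hm, ?_⟩
  have key : ∀ t u, 0 < t → 0 < u → t ≤ u → |f t - f u| ≤ C * |Real.log t - Real.log u| := by
    intro t u ht hu htu
    have h1 := hm ht hu htu
    have h2 := hm' ht hu htu
    have h3 := Real.log_le_log ht htu
    simp only at h2
    rw [abs_sub_comm, abs_of_nonneg (by linarith), abs_sub_comm, abs_of_nonneg (by linarith)]
    linarith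
  intro t u ht hu
  rcases le_total t u with h | h
  · exact key t u ht hu h
  · rw [abs_sub_comm, abs_sub_comm (Real.log t)]
    exact key u t hu ht h

lemma hasDerivAt_of_contDiffOn_Ici {f : ℝ → ℝ} (hf : ContDiffOn ℝ 1 f (Ici 0)) {y : ℝ} (hy : 0 < y) :
    HasDerivAt f (derivWithin f (Ici 0) y) y :=
  ((hf.differentiableOn one_ne_zero y hy.le).hasDerivWithinAt).hasDerivAt (Ici_mem_nhds hy)

lemma IsPhaseWeight.monotoneOn {w : ℝ → ℝ} (h : IsPhaseWeight w) : MonotoneOn w (Ici 0) := by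
  refine monotoneOn_of_deriv_nonneg (convex_Ici 0) h.contDiffOn.continuousOn ?_ ?_
  · rw [interior_Ici]
    exact fun y hy =>
      (hasDerivAt_of_contDiffOn_Ici h.contDiffOn hy).differentiableAt.differentiableWithinAt
  · rw [interior_Ici]
    intro y hy
    rw [(hasDerivAt_of_contDiffOn_Ici h.contDiffOn hy).deriv]
    exact h.deriv_nonneg y (le_of_lt hy)

lemma IsPhaseWeight.isLogLipschitz {w : ℝ → ℝ} (h : IsPhaseWeight w) :
    ∃ K, IsLogLipschitz K w := by
  obtain ⟨C, -, hC⟩ := h.deriv_le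
  refine ⟨C, fun t ht => h.pos t ht.le, ?_⟩
  refine (monotoneOn_and_abs_sub_le_log (f := fun y => Real.log (w y))
    (fun y hy => (hasDerivAt_of_contDiffOn_Ici h.contDiffOn hy).log (h.pos y hy.le).ne')
    (fun y hy => div_nonneg (h.deriv_nonneg y hy.le) (h.pos y hy.le).le) (fun y hy => ?_)).2
  rw [← mul_div_assoc, div_le_iff₀ (h.pos y hy.le)]
  exact hC y hy.le

/-- The product condition forces sub-polynomial growth: it gives `w (x ^ 2) ≤ 2 C w x`, which beats
every power when iterated. -/
lemma IsPhaseWeight.exists_le_rpow {w : ℝ → ℝ} (h : IsPhaseWeight w) {ε : ℝ} (hε : 0 < ε) :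
    ∃ K, 0 < K ∧ ∀ z, 1 ≤ z → w z ≤ K * z ^ ε := by
  obtain ⟨C, hC0, hC⟩ := h.mul_le
  -- the base point `x₀` is chosen with `2 C ≤ x₀ ^ (ε / 2)`
  set x₀ : ℝ := (2 * C + 2) ^ (2 / ε) with hx₀
  have hx1 : 1 < x₀ := Real.one_lt_rpow (by linarith) (by positivity)
  have hx2 : x₀ ^ (ε / 2) = 2 * C + 2 := by
    rw [hx₀, ← Real.rpow_mul (by linarith)]
    have : 2 / ε * (ε / 2) = 1 := by field_simp
    rw [this, Real.rpow_one]
  have hw0 := h.pos x₀ (by linarith)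
  have main : ∀ n : ℕ, ∀ z, 1 ≤ z → z ≤ x₀ ^ (2 ^ n) → w z ≤ w x₀ * z ^ ε := by
    have base : ∀ z, 1 ≤ z → z ≤ x₀ → w z ≤ w x₀ * z ^ ε := fun z hz hz' =>
      (h.monotoneOn (show (0 : ℝ) ≤ z by linarith) (show (0 : ℝ) ≤ x₀ by linarith) hz').trans
        (le_mul_of_one_le_right hw0.le (Real.one_le_rpow hz hε.le))
    intro n
    induction n with
    | zero => simpa using base
    | succ n ih =>
      intro z hz hz'
      rcases le_total z x₀ with hzx | hzx
      · exact base z hz hzx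
      have hz0 : 0 ≤ z := by linarith
      have hs1 : 1 ≤ Real.sqrt z := Real.one_le_sqrt.2 hz
      have hs2 : Real.sqrt z ≤ x₀ ^ (2 ^ n) := by
        rw [Real.sqrt_le_left (by positivity), ← pow_mul]
        exact hz'
      have h1 := hC (Real.sqrt z) (Real.sqrt z) (by positivity) (by positivity)
      rw [Real.mul_self_sqrt hz0] at h1
      have h2 := ih _ hs1 hs2
      have h3 : Real.sqrt z ^ ε = z ^ (ε / 2) := by
        rw [Real.sqrt_eq_rpow, ← Real.rpow_mul hz0]; congr 1; ring
      have h4 : z ^ ε = z ^ (ε / 2) * z ^ (ε / 2) := by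
        rw [← Real.rpow_add (by linarith)]; congr 1; ring
      have h5 : 2 * C ≤ z ^ (ε / 2) := by
        have := Real.rpow_le_rpow (by linarith) hzx (show 0 ≤ ε / 2 by positivity)
        linarith
      rw [h3] at h2
      rw [h4]
      calc w z ≤ 2 * C * w (Real.sqrt z) := by linarith
        _ ≤ 2 * C * (w x₀ * z ^ (ε / 2)) := by gcongr
        _ ≤ z ^ (ε / 2) * (w x₀ * z ^ (ε / 2)) := by gcongr
        _ = _ := by ring
  refine ⟨w x₀, hw0, fun z hz => ?_⟩
  obtain ⟨n, hn⟩ := pow_unbounded_of_one_lt z hx1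
  exact main n z hz (hn.le.trans (pow_le_pow_right₀ hx1.le Nat.lt_two_pow_self.le))

lemma IsPhaseWeight.exists_mul_le_rpow {w : ℝ → ℝ} (h : IsPhaseWeight w) {ε : ℝ} (hε : 0 < ε) :
    ∃ K, 0 < K ∧ ∀ z y, 1 ≤ z → 0 ≤ y → w (z * y) ≤ K * z ^ ε * w y := by
  obtain ⟨K, hK0, hK⟩ := h.exists_le_rpow hε
  obtain ⟨C, hC0, hC⟩ := h.mul_le
  have hw := h.pos 0 le_rfl
  refine ⟨C * (K / w 0 + 1), by positivity, fun z y hz hy => ?_⟩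
  have h1 : 1 ≤ z ^ ε := Real.one_le_rpow hz hε.le
  have h2 : w 0 ≤ w y := h.monotoneOn (show (0 : ℝ) ≤ 0 from le_rfl) hy hy
  have h3 : K * z ^ ε ≤ K / w 0 * z ^ ε * w y := by
    rw [div_mul_eq_mul_div, div_mul_eq_mul_div, le_div_iff₀ hw]
    gcongr
  have h4 : w y ≤ z ^ ε * w y := le_mul_of_one_le_left (h.pos y hy).le h1
  calc w (z * y) ≤ C * (w z + w y) := hC z y (by linarith) hy
    _ ≤ C * (K / w 0 * z ^ ε * w y + z ^ ε * w y) := by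
        have := hK z hz
        gcongr
        linarith
    _ = _ := by ring

lemma MemMW.pos {w : ℝ → ℝ} (h : MemMW w) {y : ℝ} (hy : 0 ≤ y) : 0 < w y := by
  obtain ⟨wa, wb, ha, hb, e⟩ := h
  rw [e y hy]
  exact div_pos (ha.pos y hy) (hb.pos y hy)

lemma MemMW.continuousOn {w : ℝ → ℝ} (h : MemMW w) : ContinuousOn w (Ici 0) := by
  obtain ⟨wa, wb, ha, hb, e⟩ := h
  exact (ha.contDiffOn.continuousOn.div hb.contDiffOn.continuousOn
    fun y hy => (hb.pos y hy).ne').congr fun y hy => e y hy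

lemma MemMW.isLogLipschitz {w : ℝ → ℝ} (h : MemMW w) : ∃ K, IsLogLipschitz K w := by
  obtain ⟨wa, wb, ha, hb, e⟩ := h
  obtain ⟨Ka, hKa⟩ := ha.isLogLipschitz
  obtain ⟨Kb, hKb⟩ := hb.isLogLipschitz
  exact ⟨Ka + Kb, (hKa.mul hKb.inv).congr fun t ht => by rw [e t ht.le, div_eq_mul_inv]⟩

/-- A weight of the class decays slower than every negative power, uniformly in the base point. -/
lemma MemMW.exists_le_rpow_mul {w : ℝ → ℝ} (h : MemMW w) {ε : ℝ} (hε : 0 < ε) :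
    ∃ K, 0 < K ∧ ∀ y t, 0 < y → y / 4 ≤ t → w y ≤ K * (t / y) ^ ε * w t := by
  obtain ⟨wa, wb, ha, hb, e⟩ := h
  obtain ⟨Ka, hKa0, hKa⟩ := ha.exists_mul_le_rpow hε
  obtain ⟨Kb, hKb0, hKb⟩ := hb.exists_mul_le_rpow hε
  have h4 : (0 : ℝ) < 4 ^ ε := by positivity
  refine ⟨Ka * 4 ^ ε * (Kb * 4 ^ ε), by positivity, fun y t hy hyt => ?_⟩
  have ht : 0 < t := by linarith
  have hty : 1 ≤ 4 * (t / y) := by rw [← mul_div_assoc, le_div_iff₀ hy]; linarith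
  have h1 : wa y ≤ Ka * 4 ^ ε * wa t :=
    (ha.monotoneOn hy.le (show (0 : ℝ) ≤ 4 * t by linarith) (by linarith)).trans
      (hKa 4 t (by norm_num) ht.le)
  have h2 : wb t ≤ Kb * 4 ^ ε * (t / y) ^ ε * wb y := by
    have := hKb (4 * (t / y)) y hty hy.le
    rw [Real.mul_rpow (by norm_num) (by positivity), ← mul_assoc] at this
    refine (hb.monotoneOn ht.le (show (0 : ℝ) ≤ 4 * (t / y) * y by positivity) ?_).trans this
    rw [mul_assoc, div_mul_cancel₀ _ hy.ne']
    linarith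
  have hbt := hb.pos t ht.le
  have hby := hb.pos y hy.le
  have hat := ha.pos t ht.le
  rw [e y hy.le, e t ht.le, div_le_iff₀ hby]
  calc wa y ≤ Ka * 4 ^ ε * wa t := h1
    _ = Ka * 4 ^ ε * (wa t / wb t) * wb t := by field_simp
    _ ≤ Ka * 4 ^ ε * (wa t / wb t) * (Kb * 4 ^ ε * (t / y) ^ ε * wb y) := by gcongr
    _ = _ := by ring

lemma MemMS.monotoneOn_and_abs_sub_le {m ν : ℝ → ℝ} (h : MemMS m ν) :
    ∃ C, 0 < C ∧ MonotoneOn ν (Ioi 0) ∧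
      ∀ t u, 0 < t → 0 < u → |ν t - ν u| ≤ C * |Real.log t - Real.log u| := by
  obtain ⟨C, hC0, hC⟩ := h.deriv_le
  exact ⟨C, hC0, monotoneOn_and_abs_sub_le_log
    (fun y hy => hasDerivAt_of_contDiffOn_Ici h.contDiffOn hy)
    (fun y hy => h.deriv_nonneg y hy.le) (fun y hy => hC y hy.le)⟩

/-! ### Symbols localized to one dyadic annulus -/

lemma SchwartzMap.exists_norm_le_and_norm_sub_le (φ : 𝓢(Plane, ℝ)) :
    ∃ B, 0 < B ∧ (∀ x, |φ x| ≤ B) ∧ ∀ x y, |φ x - φ y| ≤ B * ‖x - y‖ := by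
  obtain ⟨C₀, hC₀⟩ := φ.decay 0 0
  obtain ⟨C₁, hC₁⟩ := φ.decay 0 1
  refine ⟨max C₀ C₁, lt_max_of_lt_left hC₀.1, fun x => ?_, fun x y => ?_⟩
  · have := hC₀.2 x
    simp only [pow_zero, one_mul, norm_iteratedFDeriv_zero, Real.norm_eq_abs] at this
    exact this.trans (le_max_left _ _)
  · have hd : ∀ z, ‖fderiv ℝ φ z‖ ≤ max C₀ C₁ := fun z => by
      have := hC₁.2 z
      simp only [pow_zero, one_mul, norm_iteratedFDeriv_one] at this
      exact this.trans (le_max_right _ _)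
    exact convex_univ.norm_image_sub_le_of_norm_fderiv_le
      (fun z _ => φ.differentiable z) (fun z _ => hd z) (mem_univ y) (mem_univ x)

/-- A function `β` on the plane is a bump symbol with constant `B` if it vanishes outside the annulus of index `0`
and is bounded and Lipschitz with constant `B`. -/
structure IsBumpSymbol (B : ℝ) (β : Plane → ℂ) : Prop where
  eq_zero : ∀ x, x ∉ dyadicAnnulus 0 → β x = 0
  norm_le : ∀ x, ‖β x‖ ≤ B
  norm_sub_le : ∀ x y, ‖β x - β y‖ ≤ B * ‖x - y‖

lemma IsLittlewoodPaley.isBumpSymbol_mul {φ : 𝓢(Plane, ℝ)} (hφ : IsLittlewoodPaley φ) {P : ℝ}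
    (hP : 0 ≤ P) : ∃ B, 0 < B ∧ ∀ p : Plane → ℂ, (∀ x, ‖p x‖ ≤ P * ‖x‖) →
      (∀ x y, ‖p x - p y‖ ≤ P * ‖x - y‖) → IsBumpSymbol B (fun x => (φ x : ℂ) * p x) := by
  obtain ⟨B, hB, hB1, hB2⟩ := SchwartzMap.exists_norm_le_and_norm_sub_le φ
  refine ⟨3 * B * P + 1, by positivity, fun p hp1 hp2 => ?_⟩
  have hz : ∀ x, x ∉ dyadicAnnulus 0 → φ x = 0 := fun x hx =>
    image_eq_zero_of_notMem_tsupport fun h' => hx (hφ.support h')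
  have hx2 : ∀ x, x ∈ dyadicAnnulus 0 → ‖x‖ ≤ 2 := fun x hx => by
    have := hx.2
    norm_num at this
    exact this.le
  have hn : ∀ x, ‖(φ x : ℂ)‖ ≤ B := fun x => by simpa using hB1 x
  have key : ∀ x y, x ∈ dyadicAnnulus 0 →
      ‖(φ x : ℂ) * p x - (φ y : ℂ) * p y‖ ≤ (3 * B * P + 1) * ‖x - y‖ := by
    intro x y hx
    have h1 : (φ x : ℂ) * p x - (φ y : ℂ) * p y =
        ((φ x - φ y : ℝ) : ℂ) * p x + (φ y : ℂ) * (p x - p y) := by push_cast; ring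
    have h2 : ‖((φ x - φ y : ℝ) : ℂ)‖ ≤ B * ‖x - y‖ := by
      rw [Complex.norm_real]; exact hB2 x y
    have h3 : ‖p x‖ ≤ P * 2 := (hp1 x).trans (by gcongr; exact hx2 x hx)
    calc _ ≤ ‖((φ x - φ y : ℝ) : ℂ)‖ * ‖p x‖ + ‖(φ y : ℂ)‖ * ‖p x - p y‖ := by
          rw [h1, ← norm_mul, ← norm_mul]; exact norm_add_le _ _
      _ ≤ (B * ‖x - y‖) * (P * 2) + B * (P * ‖x - y‖) := by
          gcongr
          · exact hn y
          · exact hp2 x y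
      _ ≤ _ := by nlinarith [norm_nonneg (x - y)]
  refine ⟨fun x hx => by simp [hz x hx], fun x => ?_, fun x y => ?_⟩
  · by_cases hx : x ∈ dyadicAnnulus 0
    · rw [norm_mul]
      calc _ ≤ B * (P * 2) := by
            gcongr
            · exact hn x
            · exact (hp1 x).trans (by gcongr; exact hx2 x hx)
        _ ≤ _ := by nlinarith [mul_nonneg hB.le hP]
    · rw [hz x hx]; simp; positivity
  · by_cases hx : x ∈ dyadicAnnulus 0
    · exact key x y hx
    by_cases hy : y ∈ dyadicAnnulus 0
    · rw [norm_sub_rev, norm_sub_rev x]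
      exact key y x hy
    · rw [hz x hx, hz y hy]; simp; positivity

lemma two_zpow_smul_mem_dyadicAnnulus {j : ℤ} {x : Plane} :
    (2 : ℝ) ^ (-j) • x ∈ dyadicAnnulus 0 ↔ x ∈ dyadicAnnulus j := by
  have h2 : (0 : ℝ) < 2 ^ j := by positivity
  simp only [dyadicAnnulus, mem_ofPred_eq, norm_smul, zpow_neg, norm_inv, norm_zpow, Real.norm_ofNat,
    zpow_sub₀ (two_ne_zero' ℝ), zpow_add₀ (two_ne_zero' ℝ), zpow_zero, zpow_one]
  rw [inv_mul_eq_div, lt_div_iff₀ h2, div_lt_iff₀ h2]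
  constructor <;> rintro ⟨h, h'⟩ <;> constructor <;> linarith

/-- The radial factor `p(|ξ|) exp(λ ν(|ξ|))` times the rescaled bump `2 ^ j β(2 ^ (-j) ξ)`. Only the
bump distinguishes the operators with `∂_ℓ` from the one with an additional power of `Λ`. -/
noncomputable def dyadicSymbol (p ν : ℝ → ℝ) (β : Plane → ℂ) (lam : ℝ) (j : ℤ) (ξ : Plane) : ℂ :=
  ((p ‖ξ‖ * Real.exp (lam * ν ‖ξ‖) : ℝ) : ℂ) * (((2 : ℝ) ^ j : ℝ) * β ((2 : ℝ) ^ (-j) • ξ))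

lemma dyadicSymbol_eq_zero {p ν : ℝ → ℝ} {β : Plane → ℂ} {B lam : ℝ} (hβ : IsBumpSymbol B β) {j : ℤ}
    {ξ : Plane} (hξ : ξ ∉ dyadicAnnulus j) : dyadicSymbol p ν β lam j ξ = 0 := by
  rw [dyadicSymbol, hβ.eq_zero _ (fun h => hξ (two_zpow_smul_mem_dyadicAnnulus.1 h))]
  simp

lemma norm_pos_of_mem_dyadicAnnulus {j : ℤ} {ξ : Plane} (h : ξ ∈ dyadicAnnulus j) : 0 < ‖ξ‖ :=
  lt_trans (by positivity) h.1

lemma dyadicAnnulus_bounds {j : ℤ} {ξ : Plane} (h : ξ ∈ dyadicAnnulus j) :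
    (2 : ℝ) ^ j / 2 < ‖ξ‖ ∧ ‖ξ‖ < 2 * 2 ^ j := by
  have := h
  simp only [dyadicAnnulus, mem_ofPred_eq, zpow_sub₀ (two_ne_zero' ℝ), zpow_add₀ (two_ne_zero' ℝ),
    zpow_one] at this
  exact ⟨this.1, by linarith [this.2]⟩

section

variable {p ν : ℝ → ℝ} {K N : ℝ}

lemma norm_dyadicSymbol_le {β : Plane → ℂ} {B : ℝ} (hp : IsLogLipschitz K p) (hβ : IsBumpSymbol B β)
    (lam : ℝ) (j : ℤ) (ξ : Plane) :
    ‖dyadicSymbol p ν β lam j ξ‖ ≤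
      4 ^ K * B * p (2 ^ j) * 2 ^ j * Real.exp (lam * ν ‖ξ‖) := by
  have h2 : (0 : ℝ) < 2 ^ j := by positivity
  have hB : 0 ≤ B := (norm_nonneg _).trans (hβ.norm_le 0)
  have hp2 := hp.1 _ h2
  by_cases hξ : ξ ∈ dyadicAnnulus j
  · have hb := dyadicAnnulus_bounds hξ
    have h0 := norm_pos_of_mem_dyadicAnnulus hξ
    have h1 := hp.le_rpow_mul (R := 4) h0 h2 (by norm_num) (by linarith) (by linarith)
    have hpx := hp.1 _ h0
    rw [dyadicSymbol, norm_mul, norm_mul, Complex.norm_real, Complex.norm_real, Real.norm_eq_abs,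
      Real.norm_eq_abs, abs_of_pos (by positivity), abs_of_pos h2]
    calc _ ≤ (4 ^ K * p (2 ^ j)) * Real.exp (lam * ν ‖ξ‖) * (2 ^ j * B) := by
          gcongr
          exact hβ.norm_le _
      _ = _ := by ring
  · rw [dyadicSymbol_eq_zero hβ hξ, norm_zero]
    positivity

/-- The logarithmic growth of `ν` makes it subadditive up to a constant. -/
lemma apply_norm_le_add {ξ ζ η : Plane} (hmono : MonotoneOn ν (Ioi 0)) (h0 : ∀ y, 0 ≤ y → 0 ≤ ν y)
    (hN : ∀ t u, 0 < t → 0 < u → |ν t - ν u| ≤ N * |Real.log t - Real.log u|)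
    (hξ : 0 < ‖ξ‖) (h : ξ = ζ + η) : ν ‖ξ‖ ≤ ν ‖ζ‖ + ν ‖η‖ + N * Real.log 2 := by
  have key : ∀ t : ℝ, 0 < t → ‖ξ‖ ≤ 2 * t → ν ‖ξ‖ ≤ ν t + N * Real.log 2 := by
    intro t ht hle
    have h1 := hmono hξ (show (0 : ℝ) < 2 * t by linarith) hle
    have h2 := (abs_le.1 (hN (2 * t) t (by linarith) ht)).2
    rw [Real.log_mul two_ne_zero ht.ne', add_sub_cancel_right,
      abs_of_pos (Real.log_pos one_lt_two)] at h2
    linarith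
  have hle : ‖ξ‖ ≤ ‖ζ‖ + ‖η‖ := h ▸ norm_add_le _ _
  have hz := h0 ‖ζ‖ (norm_nonneg _)
  have he := h0 ‖η‖ (norm_nonneg _)
  rcases le_total ‖ζ‖ ‖η‖ with h' | h'
  · linarith [key ‖η‖ (by linarith) (by linarith)]
  · linarith [key ‖ζ‖ (by linarith) (by linarith)]

/-- The estimate carrying the commutator gain. Up to the exponential weights at the two input
frequencies, the symbol is Lipschitz with constant `p(2 ^ j)`, uniformly in all frequencies:
for a small shift `η` by the regularity of the weights, and for `|η| ≳ 2 ^ j` by the size of the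
symbol alone. -/
lemma norm_dyadicSymbol_sub_le {B : ℝ} (hp : IsLogLipschitz K p) (hB : 0 < B) (hN0 : 0 < N)
    (hmono : MonotoneOn ν (Ioi 0)) (h0 : ∀ y, 0 ≤ y → 0 ≤ ν y)
    (hN : ∀ t u, 0 < t → 0 < u → |ν t - ν u| ≤ N * |Real.log t - Real.log u|) :
    ∃ c C : ℝ, 0 < c ∧ 0 < C ∧ ∀ β, IsBumpSymbol B β → ∀ lam, 0 ≤ lam → ∀ j : ℤ, ∀ ξ ζ η : Plane,
      ξ ∈ dyadicAnnulus j → ξ = ζ + η →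
      ‖dyadicSymbol p ν β lam j ξ - dyadicSymbol p ν β lam j ζ‖ ≤
        C * (1 + lam) * Real.exp (c * lam) * p (2 ^ j) *
          (Real.exp (lam * ν ‖ζ‖) * (‖η‖ * Real.exp (lam * ν ‖η‖))) := by
  have hK := hp.nonneg
  have hl2 : 0 < Real.log 2 := Real.log_pos one_lt_two
  have hl16 : Real.log 16 = 4 * Real.log 2 := by
    rw [show (16 : ℝ) = 2 ^ (4 : ℕ) by norm_num, Real.log_pow]; norm_num
  have h4K : (1 : ℝ) ≤ 4 ^ K := Real.one_le_rpow (by norm_num) hK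
  have h16K : (1 : ℝ) ≤ 16 ^ K := Real.one_le_rpow (by norm_num) hK
  refine ⟨N * Real.log 16, 8 * 4 ^ K * B + 4 ^ K * B * (4 * (16 ^ K * (K + N)) + 1),
    by rw [hl16]; positivity, by positivity, ?_⟩
  intro β hβ lam hlam j ξ ζ η hξ hsum
  have h2 : (0 : ℝ) < 2 ^ j := by positivity
  have hb := dyadicAnnulus_bounds hξ
  have hξ0 := norm_pos_of_mem_dyadicAnnulus hξ
  have hp2 := hp.1 _ h2
  set Ez := Real.exp (lam * ν ‖ζ‖) with hEz
  set Ee := Real.exp (lam * ν ‖η‖) with hEe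
  set c := N * Real.log 16 with hc
  have hc0 : 0 < c := by rw [hc, hl16]; positivity
  have hEz0 : 0 < Ez := Real.exp_pos _
  have hEe1 : 1 ≤ Ee := Real.one_le_exp (mul_nonneg hlam (h0 _ (norm_nonneg _)))
  have hEc1 : 1 ≤ Real.exp (c * lam) := Real.one_le_exp (by positivity)
  have hη0 := norm_nonneg η
  rcases le_or_gt ((2 : ℝ) ^ j / 4) ‖η‖ with hη | hη
  · -- large shift: the size of the symbol suffices
    have hEx : Real.exp (lam * ν ‖ξ‖) ≤ Real.exp (c * lam) * (Ez * Ee) := by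
      rw [hEz, hEe, ← Real.exp_add, ← Real.exp_add, Real.exp_le_exp]
      have := mul_le_mul_of_nonneg_left (apply_norm_le_add hmono h0 hN hξ0 hsum) hlam
      have h3 : lam * (N * Real.log 2) ≤ c * lam := by
        rw [hc, hl16]; nlinarith [mul_nonneg hlam (mul_pos hN0 hl2).le]
      nlinarith
    have hEz' : Ez ≤ Real.exp (c * lam) * (Ez * Ee) :=
      calc Ez ≤ Ez * Ee := le_mul_of_one_le_right hEz0.le hEe1
        _ ≤ _ := le_mul_of_one_le_left (by positivity) hEc1
    have h1 := norm_dyadicSymbol_le (ν := ν) hp hβ lam j ξ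
    have h1' := norm_dyadicSymbol_le (ν := ν) hp hβ lam j ζ
    set X := Real.exp (c * lam) * (Ez * Ee) with hX
    calc _ ≤ ‖dyadicSymbol p ν β lam j ξ‖ + ‖dyadicSymbol p ν β lam j ζ‖ := norm_sub_le _ _
      _ ≤ 4 ^ K * B * p (2 ^ j) * (4 * ‖η‖) * X + 4 ^ K * B * p (2 ^ j) * (4 * ‖η‖) * X := by
          refine add_le_add (h1.trans ?_) (h1'.trans ?_)
          · gcongr; linarith
          · gcongr; linarith
      _ = (8 * 4 ^ K * B) * 1 * Real.exp (c * lam) * p (2 ^ j) * (Ez * (‖η‖ * Ee)) := by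
          rw [hX]; ring
      _ ≤ _ := by
          gcongr
          · have : 0 ≤ 4 ^ K * B * (4 * (16 ^ K * (K + N)) + 1) := by positivity
            linarith
          · linarith
  · -- small shift: both frequencies lie in the same enlarged annulus
    have hζ1 : (2 : ℝ) ^ j / 4 ≤ ‖ζ‖ := by
      have : ‖ξ‖ ≤ ‖ζ‖ + ‖η‖ := hsum ▸ norm_add_le _ _
      linarith
    have hζ2 : ‖ζ‖ ≤ 4 * 2 ^ j := by
      have : ‖ζ‖ ≤ ‖ξ‖ + ‖η‖ := by
        have : ζ = ξ - η := by rw [hsum]; abel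
        rw [this]; exact norm_sub_le _ _
      linarith
    have hζ0 : 0 < ‖ζ‖ := by linarith
    have hdiff : |‖ξ‖ - ‖ζ‖| ≤ ‖η‖ := by
      have := abs_norm_sub_norm_le ξ ζ
      rwa [show ξ - ζ = η by rw [hsum]; abel] at this
    have hlog : |Real.log ‖ξ‖ - Real.log ‖ζ‖| ≤ 4 * ‖η‖ / 2 ^ j := by
      have := abs_log_sub_log_le (a := 2 ^ j / 4) (by positivity) (by linarith : _ ≤ ‖ξ‖) hζ1
      refine this.trans ?_
      rw [div_div_eq_mul_div, mul_comm]
      gcongr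
    have hq := hp.mul (IsLogLipschitz.exp hN hlam)
    set q : ℝ → ℝ := fun t => p t * Real.exp (lam * ν t) with hqdef
    have hqsub := hq.abs_sub_le (R := 16) hξ0 hζ0 (by norm_num) (by linarith) (by linarith)
    have hqz : q ‖ζ‖ ≤ 4 ^ K * p (2 ^ j) * Ez := by
      simp only [hqdef]
      gcongr
      exact hp.le_rpow_mul (R := 4) hζ0 h2 (by norm_num) (by linarith) (by linarith)
    have hqz0 := hq.1 _ hζ0
    have h16 : (16 : ℝ) ^ (K + lam * N) = 16 ^ K * Real.exp (c * lam) := by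
      rw [Real.rpow_add (by norm_num), Real.rpow_def_of_pos (by norm_num) (lam * N), hc]
      congr 2; ring
    have hM : K + lam * N ≤ (K + N) * (1 + lam) := by nlinarith [mul_nonneg hK hlam]
    have e1 : dyadicSymbol p ν β lam j ξ - dyadicSymbol p ν β lam j ζ =
        (((2 : ℝ) ^ j : ℝ) : ℂ) * (((q ‖ξ‖ - q ‖ζ‖ : ℝ) : ℂ) * β ((2 : ℝ) ^ (-j) • ξ) +
          (q ‖ζ‖ : ℂ) * (β ((2 : ℝ) ^ (-j) • ξ) - β ((2 : ℝ) ^ (-j) • ζ))) := by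
      simp only [dyadicSymbol, hqdef]
      push_cast
      ring
    have e2 : ‖β ((2 : ℝ) ^ (-j) • ξ) - β ((2 : ℝ) ^ (-j) • ζ)‖ ≤ B * (‖η‖ / 2 ^ j) := by
      refine (hβ.norm_sub_le _ _).trans (le_of_eq ?_)
      rw [← smul_sub, show ξ - ζ = η by rw [hsum]; abel, norm_smul, zpow_neg, norm_inv, norm_zpow,
        Real.norm_ofNat, inv_mul_eq_div]
    have e3 : |q ‖ξ‖ - q ‖ζ‖| ≤ (4 ^ K * p (2 ^ j) * Ez) *
        ((16 ^ K * Real.exp (c * lam)) * ((K + N) * (1 + lam))) * (4 * ‖η‖ / 2 ^ j) := by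
      refine hqsub.trans ?_
      rw [h16]
      gcongr
    calc _ ≤ 2 ^ j * (|q ‖ξ‖ - q ‖ζ‖| * B + q ‖ζ‖ * (B * (‖η‖ / 2 ^ j))) := by
          rw [e1, norm_mul]
          have n1 : ‖(((2 : ℝ) ^ j : ℝ) : ℂ)‖ = 2 ^ j := by
            rw [Complex.norm_real, Real.norm_eq_abs, abs_of_pos h2]
          rw [n1]
          refine mul_le_mul_of_nonneg_left ((norm_add_le _ _).trans (add_le_add ?_ ?_)) h2.le
          · rw [norm_mul, Complex.norm_real, Real.norm_eq_abs]
            gcongr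
            exact hβ.norm_le _
          · rw [norm_mul, Complex.norm_real, Real.norm_eq_abs, abs_of_pos hqz0]
            gcongr
      _ ≤ 2 ^ j * ((4 ^ K * p (2 ^ j) * Ez) *
            ((16 ^ K * Real.exp (c * lam)) * ((K + N) * (1 + lam))) * (4 * ‖η‖ / 2 ^ j) * B +
          (4 ^ K * p (2 ^ j) * Ez) * (B * (‖η‖ / 2 ^ j))) := by gcongr
      _ = 4 ^ K * B * (4 * (16 ^ K * (K + N)) * ((1 + lam) * Real.exp (c * lam)) + 1) *
            p (2 ^ j) * (Ez * (‖η‖ * 1)) := by field_simp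
      _ ≤ 4 ^ K * B * (4 * (16 ^ K * (K + N)) * ((1 + lam) * Real.exp (c * lam)) +
            (1 + lam) * Real.exp (c * lam)) * p (2 ^ j) * (Ez * (‖η‖ * Ee)) := by
          have : 1 ≤ (1 + lam) * Real.exp (c * lam) :=
            one_le_mul_of_one_le_of_one_le (by linarith) hEc1
          gcongr
      _ = (4 ^ K * B * (4 * (16 ^ K * (K + N)) + 1)) * (1 + lam) * Real.exp (c * lam) *
            p (2 ^ j) * (Ez * (‖η‖ * Ee)) := by ring
      _ ≤ _ := by
          gcongr
          have : 0 ≤ 8 * 4 ^ K * B := by positivity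
          linarith

end

lemma zero_notMem_dyadicAnnulus (j : ℤ) : (0 : Plane) ∉ dyadicAnnulus j := fun h =>
  (norm_pos_of_mem_dyadicAnnulus h).ne' norm_zero

/-- The symbols of the operators `ω(D) Λ^r E Δ_j ∂_ℓ` and `ω(D) Λ^(r+1) E Δ_j` are dyadic symbols,
with bumps independent of `j` and `λ`. -/
lemma IsLittlewoodPaley.exists_eq_dyadicSymbol {φ : 𝓢(Plane, ℝ)} (hφ : IsLittlewoodPaley φ) :
    ∃ B, 0 < B ∧ ∀ (ω ν : ℝ → ℝ) (r lam : ℝ) (j : ℤ) (a : Plane → ℂ),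
      ((∃ ℓ : Fin 2, a = radialSymbol ω * lambdaSymbol r * gevreySymbol lam ν *
          blockSymbol φ j * partialSymbol ℓ) ∨
        a = radialSymbol ω * lambdaSymbol (r + 1) * gevreySymbol lam ν * blockSymbol φ j) →
      ∃ β, Measurable β ∧ IsBumpSymbol B β ∧
        a = dyadicSymbol (fun t => ω t * t ^ r) ν β lam j := by
  have hP : (0 : ℝ) ≤ 2 * Real.pi := by positivity
  obtain ⟨B, hB, hBump⟩ := hφ.isBumpSymbol_mul hP
  have hφc : Continuous φ := φ.continuous
  have hpi : ‖(2 * Real.pi * Complex.I : ℂ)‖ = 2 * Real.pi := by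
    simp [abs_of_pos Real.pi_pos]
  refine ⟨B, hB, fun ω ν r lam j a ha => ?_⟩
  have h2 : (2 : ℝ) ^ j ≠ 0 := by positivity
  rcases ha with ⟨ℓ, rfl⟩ | rfl
  · refine ⟨fun x => (φ x : ℂ) * (2 * Real.pi * Complex.I * (x ℓ : ℂ)), ?_, hBump _ ?_ ?_, ?_⟩
    · exact Continuous.measurable (by fun_prop)
    · intro x
      rw [norm_mul, hpi, Complex.norm_real]
      gcongr
      exact PiLp.norm_apply_le x ℓ
    · intro x y
      rw [← mul_sub, norm_mul, hpi, ← Complex.ofReal_sub, Complex.norm_real, ← PiLp.sub_apply]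
      gcongr
      exact PiLp.norm_apply_le (x - y) ℓ
    · ext ξ
      simp only [Pi.mul_apply, radialSymbol, lambdaSymbol, gevreySymbol, blockSymbol, partialSymbol,
        dyadicSymbol, PiLp.smul_apply, smul_eq_mul, zpow_neg]
      push_cast
      have h2' : (2 : ℂ) ^ j ≠ 0 := zpow_ne_zero j two_ne_zero
      field_simp
  · refine ⟨fun x => (φ x : ℂ) * ((‖x‖ : ℝ) : ℂ), ?_, hBump _ ?_ ?_, ?_⟩
    · exact Continuous.measurable (by fun_prop)
    · intro x
      rw [Complex.norm_real, norm_norm]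
      exact le_mul_of_one_le_left (norm_nonneg _) (by linarith [Real.pi_gt_three])
    · intro x y
      rw [← Complex.ofReal_sub, Complex.norm_real]
      exact (abs_norm_sub_norm_le x y).trans
        (le_mul_of_one_le_left (norm_nonneg _) (by linarith [Real.pi_gt_three]))
    · ext ξ
      simp only [Pi.mul_apply, radialSymbol, lambdaSymbol, gevreySymbol, blockSymbol,
        dyadicSymbol]
      rcases eq_or_ne ξ 0 with rfl | hξ
      · have : φ 0 = 0 :=
          image_eq_zero_of_notMem_tsupport fun h => zero_notMem_dyadicAnnulus 0 (hφ.support h)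
        simp [this]
      · rw [Real.rpow_add_one (norm_ne_zero_iff.2 hξ), norm_smul, zpow_neg, norm_inv, norm_zpow,
          Real.norm_ofNat]
        push_cast
        have h2' : (2 : ℂ) ^ j ≠ 0 := zpow_ne_zero j two_ne_zero
        field_simp

/-! ### Trilinear convolution bounds -/

lemma lintegral_mul_le_eLpNorm_two {α : Type*} [MeasurableSpace α] {μ : Measure α}
    {u v : α → ℝ≥0∞} (hu : AEMeasurable u μ) (hv : AEMeasurable v μ) :
    ∫⁻ x, u x * v x ∂μ ≤ eLpNorm u 2 μ * eLpNorm v 2 μ := by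
  have h := ENNReal.lintegral_mul_le_Lp_mul_Lq μ Real.HolderConjugate.two_two hu hv
  rw [eLpNorm_eq_lintegral_rpow_enorm_toReal two_ne_zero ENNReal.ofNat_ne_top,
    eLpNorm_eq_lintegral_rpow_enorm_toReal two_ne_zero ENNReal.ofNat_ne_top]
  simpa using h

lemma eLpNorm_two_sq {α : Type*} [MeasurableSpace α] {μ : Measure α} (u : α → ℝ≥0∞) :
    eLpNorm u 2 μ ^ 2 = ∫⁻ x, u x ^ 2 ∂μ := by
  have h := eLpNorm_nnreal_pow_eq_lintegral (μ := μ) (f := u) (p := 2) two_ne_zero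
  simpa using h

section

variable {u v h : Plane → ℝ≥0∞}

lemma aemeasurable_comp_sub_prod (hu : AEMeasurable u volume) :
    AEMeasurable (fun p : Plane × Plane => u (p.1 - p.2)) (volume.prod volume) :=
  hu.comp_quasiMeasurePreserving
    (quasiMeasurePreserving_sub_of_right_invariant (volume : Measure Plane) volume)

lemma aemeasurable_trilinear (hu : AEMeasurable u volume) (hv : AEMeasurable v volume)
    (hh : AEMeasurable h volume) :
    AEMeasurable (fun p : Plane × Plane => u (p.1 - p.2) * v p.2 * h p.1)
      (volume.prod volume) :=
  ((aemeasurable_comp_sub_prod hu).mul hv.comp_snd).mul hh.comp_fst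

lemma aemeasurable_comp_sub_left (hu : AEMeasurable u volume) (ξ : Plane) :
    AEMeasurable (fun η => u (ξ - η)) volume :=
  hu.comp_quasiMeasurePreserving (quasiMeasurePreserving_sub_left_of_right_invariant volume ξ)

/-- The trilinear form `∫∫ u(ξ - η) v(η) h(ξ) dη dξ` of nonnegative functions. -/
noncomputable def trilinear (u v h : Plane → ℝ≥0∞) : ℝ≥0∞ :=
  ∫⁻ ξ, ∫⁻ η, u (ξ - η) * v η * h ξ

lemma trilinear_eq_lintegral_prod (hu : AEMeasurable u volume) (hv : AEMeasurable v volume)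
    (hh : AEMeasurable h volume) :
    trilinear u v h = ∫⁻ p : Plane × Plane, u (p.1 - p.2) * v p.2 * h p.1 ∂(volume.prod volume) :=
  (lintegral_prod _ (aemeasurable_trilinear hu hv hh)).symm

lemma trilinear_comm (u v h : Plane → ℝ≥0∞) : trilinear u v h = trilinear v u h := by
  refine lintegral_congr fun ξ => ?_
  rw [← lintegral_sub_left_eq_self _ ξ]
  simp only [sub_sub_cancel]
  exact lintegral_congr fun η => by ring

lemma eLpNorm_comp_sub_left (hu : AEMeasurable u volume) (ξ : Plane) :
    eLpNorm (fun η => u (ξ - η)) 2 volume = eLpNorm u 2 volume :=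
  eLpNorm_comp_measurePreserving hu.aestronglyMeasurable
    (Measure.measurePreserving_sub_left volume ξ)

lemma eLpNorm_comp_sub_right (hu : AEMeasurable u volume) (η : Plane) :
    eLpNorm (fun ξ => u (ξ - η)) 2 volume = eLpNorm u 2 volume :=
  eLpNorm_comp_measurePreserving hu.aestronglyMeasurable
    (measurePreserving_sub_right volume η)

lemma trilinear_le_two_one_two (hu : AEMeasurable u volume) (hv : AEMeasurable v volume)
    (hh : AEMeasurable h volume) :
    trilinear u v h ≤ eLpNorm u 2 volume * (∫⁻ η, v η) * eLpNorm h 2 volume := by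
  rw [trilinear, lintegral_lintegral_swap (aemeasurable_trilinear hu hv hh)]
  calc _ ≤ ∫⁻ η, v η * (eLpNorm u 2 volume * eLpNorm h 2 volume) := by
        refine lintegral_mono fun η => ?_
        have hu' : AEMeasurable (fun ξ => u (ξ - η)) volume :=
          hu.comp_quasiMeasurePreserving
            (measurePreserving_sub_right volume η).quasiMeasurePreserving
        calc _ = ∫⁻ ξ, v η * (u (ξ - η) * h ξ) := lintegral_congr fun ξ => by ring
          _ = v η * ∫⁻ ξ, u (ξ - η) * h ξ := lintegral_const_mul'' _ (hu'.mul hh)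
          _ ≤ _ := by
            gcongr
            exact (lintegral_mul_le_eLpNorm_two hu' hh).trans_eq (by rw [eLpNorm_comp_sub_right hu])
    _ = _ := by rw [lintegral_mul_const'' _ hv]; ring

lemma trilinear_le_one_two_two (hu : AEMeasurable u volume) (hv : AEMeasurable v volume)
    (hh : AEMeasurable h volume) :
    trilinear u v h ≤ (∫⁻ η, u η) * eLpNorm v 2 volume * eLpNorm h 2 volume := by
  rw [trilinear_comm]
  exact (trilinear_le_two_one_two hv hu hh).trans_eq (by ring)

lemma trilinear_le_two_two_one (hu : AEMeasurable u volume) (hv : AEMeasurable v volume)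
    (hh : AEMeasurable h volume) :
    trilinear u v h ≤ eLpNorm u 2 volume * eLpNorm v 2 volume * ∫⁻ ξ, h ξ := by
  calc _ ≤ ∫⁻ ξ, (eLpNorm u 2 volume * eLpNorm v 2 volume) * h ξ := by
        refine lintegral_mono fun ξ => ?_
        have hu' := aemeasurable_comp_sub_left hu ξ
        have huv : AEMeasurable (fun η => u (ξ - η) * v η) volume := hu'.mul hv
        rw [lintegral_mul_const'' _ huv]
        gcongr
        exact (lintegral_mul_le_eLpNorm_two hu' hv).trans_eq (by rw [eLpNorm_comp_sub_left hu])
    _ = _ := lintegral_const_mul'' _ hh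

end

/-! ### The low-frequency integral -/

lemma lintegral_fun_norm_plane {f : ℝ → ℝ≥0∞} (hf : Measurable f) :
    ∫⁻ x : Plane, f ‖x‖ =
      (volume : Measure Plane).toSphere univ * ∫⁻ t in Ioi (0 : ℝ), ENNReal.ofReal t * f t := by
  have hdim : Module.finrank ℝ Plane - 1 = 1 := by simp
  have hmp := (volume : Measure Plane).measurePreserving_homeomorphUnitSphereProd
  rw [hdim] at hmp
  have h1 : ∫⁻ x : Plane, f ‖x‖ =
      ∫⁻ x : ({(0 : Plane)}ᶜ : Set Plane), f ‖(x : Plane)‖ ∂(volume.comap Subtype.val) := by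
    rw [lintegral_subtype_comap (measurableSet_singleton _).compl fun x : Plane => f ‖x‖,
      restrict_compl_singleton]
  have h2 := hmp.lintegral_comp_emb (Homeomorph.measurableEmbedding _)
    (fun p => f (p.2 : ℝ))
  simp only [homeomorphUnitSphereProd_apply_snd_coe] at h2
  have hf' : Measurable fun t : Ioi (0 : ℝ) => f t := hf.comp measurable_subtype_coe
  rw [h1, h2, lintegral_prod _ (by fun_prop)]
  simp only [lintegral_const]
  rw [mul_comm]
  congr 1
  rw [Measure.volumeIoiPow, lintegral_withDensity_eq_lintegral_mul _ (by fun_prop) hf',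
    ← lintegral_subtype_comap measurableSet_Ioi fun t : ℝ => ENNReal.ofReal t * f t]
  simp

/-- Cauchy–Schwarz against a radial weight on a disc. -/
lemma lintegral_ball_le {θ : ℝ → ℝ} (hθc : ContinuousOn θ (Ioi 0)) (hθ : ∀ t, 0 < t → 0 < θ t)
    {u : Plane → ℝ≥0∞} (hu : AEMeasurable u volume) (R : ℝ) :
    ∫⁻ ξ in Metric.ball (0 : Plane) R, u ξ ≤
      ((volume : Measure Plane).toSphere univ *
        ∫⁻ t in Ioo 0 R, ENNReal.ofReal (t / θ t ^ 2)) ^ (1 / 2 : ℝ) *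
      eLpNorm (fun ξ => ENNReal.ofReal (θ ‖ξ‖) * u ξ) 2 volume := by
  set k : ℝ → ℝ≥0∞ := (Ioo 0 R).indicator fun t => ENNReal.ofReal (θ t)⁻¹ with hk
  set W : ℝ → ℝ≥0∞ := (Ioi 0).indicator fun t => ENNReal.ofReal (θ t) with hW
  have hsub : Ioo 0 R ⊆ Ioi (0 : ℝ) := fun t ht => ht.1
  have hkm : Measurable k := by
    rw [hk, ← piecewise_eq_indicator]
    refine ContinuousOn.measurable_piecewise ?_ continuousOn_const measurableSet_Ioo
    exact ENNReal.continuous_ofReal.comp_continuousOn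
      ((hθc.mono hsub).inv₀ fun t ht => (hθ t ht.1).ne')
  have hWm : Measurable W := by
    rw [hW, ← piecewise_eq_indicator]
    refine ContinuousOn.measurable_piecewise ?_ continuousOn_const measurableSet_Ioi
    exact ENNReal.continuous_ofReal.comp_continuousOn hθc
  have hne : ∀ᵐ ξ : Plane, ξ ≠ 0 := Measure.ae_ne volume 0
  have h1 : ∫⁻ ξ in Metric.ball (0 : Plane) R, u ξ =
      ∫⁻ ξ, k ‖ξ‖ * (W ‖ξ‖ * u ξ) := by
    rw [← lintegral_indicator measurableSet_ball]
    refine lintegral_congr_ae ?_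
    filter_upwards [hne] with ξ hξ
    have hξ0 : 0 < ‖ξ‖ := norm_pos_iff.2 hξ
    by_cases hR : ‖ξ‖ < R
    · rw [indicator_of_mem (by simpa using hR), hk, hW,
        indicator_of_mem (show ‖ξ‖ ∈ Ioo 0 R from ⟨hξ0, hR⟩),
        indicator_of_mem (show ‖ξ‖ ∈ Ioi (0 : ℝ) from hξ0), ← mul_assoc,
        ← ENNReal.ofReal_mul (inv_nonneg.2 (hθ _ hξ0).le), inv_mul_cancel₀ (hθ _ hξ0).ne']
      simp
    · rw [indicator_of_notMem (by simpa using hR), hk, indicator_of_notMem (fun h => hR h.2),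
        zero_mul]
  have h2 : eLpNorm (fun ξ : Plane => W ‖ξ‖ * u ξ) 2 volume =
      eLpNorm (fun ξ => ENNReal.ofReal (θ ‖ξ‖) * u ξ) 2 volume := by
    refine eLpNorm_congr_ae ?_
    filter_upwards [hne] with ξ hξ
    rw [hW, indicator_of_mem (show ‖ξ‖ ∈ Ioi (0 : ℝ) from norm_pos_iff.2 hξ)]
  have h3 : eLpNorm (fun ξ : Plane => k ‖ξ‖) 2 volume =
      ((volume : Measure Plane).toSphere univ *
        ∫⁻ t in Ioo 0 R, ENNReal.ofReal (t / θ t ^ 2)) ^ (1 / 2 : ℝ) := by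
    have hsq : eLpNorm (fun ξ : Plane => k ‖ξ‖) 2 volume =
        (eLpNorm (fun ξ : Plane => k ‖ξ‖) 2 volume ^ 2) ^ (1 / 2 : ℝ) := by
      rw [← ENNReal.rpow_natCast, ← ENNReal.rpow_mul]
      norm_num
    rw [hsq, eLpNorm_two_sq, lintegral_fun_norm_plane (hkm.pow_const 2),
      ← lintegral_indicator measurableSet_Ioi, ← lintegral_indicator measurableSet_Ioo]
    congr 2
    refine lintegral_congr fun t => ?_
    by_cases ht : t ∈ Ioo 0 R
    · have h0 : 0 < θ t := hθ t ht.1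
      rw [indicator_of_mem (hsub ht), indicator_of_mem ht, hk, indicator_of_mem ht,
        ← ENNReal.ofReal_pow (inv_nonneg.2 h0.le), ← ENNReal.ofReal_mul ht.1.le, inv_pow,
        div_eq_mul_inv]
    · rw [indicator_of_notMem ht, hk]
      by_cases ht' : t ∈ Ioi (0 : ℝ)
      · rw [indicator_of_mem ht', indicator_of_notMem ht]; simp
      · rw [indicator_of_notMem ht']
  rw [h1, ← h2, ← h3]
  exact lintegral_mul_le_eLpNorm_two (hkm.comp measurable_norm).aemeasurable
    ((hWm.comp measurable_norm).aemeasurable.mul hu)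

/-- The weighted Sobolev norm occurring in the first factor of `piNorm`, for a nonnegative density. -/
noncomputable def lowNorm (s : ℝ) (w : ℝ → ℝ) (u : Plane → ℝ≥0∞) : ℝ≥0∞ :=
  if s < 1 then eLpNorm (fun ξ => ENNReal.ofReal (‖ξ‖ ^ s * w ‖ξ‖) * u ξ) 2 volume
  else eLpNorm (fun ξ => ENNReal.ofReal ((1 + ‖ξ‖ ^ 2) ^ (1 / 2 : ℝ) * w ‖ξ‖) * u ξ) 2 volume

/-- Bernstein's inequality with a weight: the low-frequency integral is the square of the norm of
the embedding into functions with integrable Fourier transform on a disc. -/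
lemma lintegral_ball_le_lowNorm {s : ℝ} (hs : s ≤ 1) {w : ℝ → ℝ} (hwc : ContinuousOn w (Ioi 0))
    (hw : ∀ t, 0 < t → 0 < w t) {u : Plane → ℝ≥0∞} (hu : AEMeasurable u volume) {R : ℝ}
    (hR : 0 < R) :
    ∫⁻ ξ in Metric.ball (0 : Plane) R, u ξ ≤
      (volume : Measure Plane).toSphere univ ^ (1 / 2 : ℝ) * ENNReal.ofReal (R ^ (1 - s)) *
        lowFreqIntegral s w R ^ (1 / 2 : ℝ) * lowNorm s w u := by
  have hhalf : (0 : ℝ) ≤ 1 / 2 := by norm_num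
  rcases hs.lt_or_eq with hs1 | rfl
  · rw [lowNorm, if_pos hs1, lowFreqIntegral, if_pos hs1]
    refine (lintegral_ball_le (θ := fun t => t ^ s * w t)
      ((continuousOn_id.rpow_const fun t ht => Or.inl (ne_of_gt ht)).mul hwc)
      (fun t ht => mul_pos (Real.rpow_pos_of_pos ht s) (hw t ht)) hu R).trans_eq ?_
    congr 1
    have himg : Ioo 0 R = (fun t => R * t) '' Ioo 0 1 := by
      rw [image_mul_left_Ioo hR]; simp
    have hder : ∀ t ∈ Ioo (0 : ℝ) 1, HasDerivWithinAt (fun t => R * t) R (Ioo 0 1) t := fun t _ => by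
      simpa using ((hasDerivAt_id t).const_mul R).hasDerivWithinAt
    rw [himg, lintegral_image_eq_lintegral_abs_deriv_mul measurableSet_Ioo hder
      (mul_right_injective₀ hR.ne').injOn]
    have hR2 : ENNReal.ofReal (R ^ (1 - s)) =
        ENNReal.ofReal (R ^ (2 - 2 * s)) ^ (1 / 2 : ℝ) := by
      rw [ENNReal.ofReal_rpow_of_nonneg (by positivity) hhalf, ← Real.rpow_mul hR.le]
      congr 2; ring
    rw [hR2, ← ENNReal.mul_rpow_of_nonneg _ _ hhalf, ← ENNReal.mul_rpow_of_nonneg _ _ hhalf,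
      mul_assoc, ← lintegral_const_mul' _ _ ENNReal.ofReal_ne_top]
    congr 2
    refine setLIntegral_congr_fun measurableSet_Ioo fun t ht => ?_
    have ht0 : 0 < t := ht.1
    have hwt := hw (R * t) (by positivity)
    rw [← ENNReal.ofReal_mul (abs_nonneg _), ← ENNReal.ofReal_mul (by positivity), abs_of_pos hR]
    congr 1
    have e1 : ((R * t) ^ s) ^ 2 = R ^ (2 * s) * t ^ (2 * s) := by
      rw [← Real.rpow_natCast, ← Real.rpow_mul (by positivity), Real.mul_rpow hR.le ht0.le]
      push_cast; rw [mul_comm s]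
    have e2 : R ^ (2 - 2 * s) = R ^ 2 / R ^ (2 * s) := by
      rw [Real.rpow_sub hR]; norm_num
    have e3 : t ^ (1 - 2 * s) = t / t ^ (2 * s) := by
      rw [Real.rpow_sub ht0, Real.rpow_one]
    have := Real.rpow_pos_of_pos hR (2 * s)
    have := Real.rpow_pos_of_pos ht0 (2 * s)
    rw [mul_pow, e1, e2, e3]
    field_simp
  · rw [lowNorm, if_neg (lt_irrefl _), lowFreqIntegral, if_neg (lt_irrefl _)]
    refine (lintegral_ball_le (θ := fun t => (1 + t ^ 2) ^ (1 / 2 : ℝ) * w t)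
      ((Continuous.continuousOn (by fun_prop (disch := norm_num))).mul hwc)
      (fun t ht => mul_pos (by positivity) (hw t ht)) hu R).trans_eq ?_
    rw [sub_self, Real.rpow_zero, ENNReal.ofReal_one, mul_one,
      ← ENNReal.mul_rpow_of_nonneg _ _ hhalf]
    congr 3
    refine lintegral_congr fun t => ?_
    rw [mul_pow, ← Real.rpow_natCast, ← Real.rpow_mul (by positivity)]
    norm_num

/-! ### Dyadic tails -/

/-- The weight `(2 ^ j / |η|) ^ δ` cut off to `|η| ≥ 2 ^ j / 4`; it is square summable in `j`. -/
noncomputable def tailWeight (δ : ℝ) (j : ℤ) (η : Plane) : ℝ≥0∞ :=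
  if (2 : ℝ) ^ j / 4 ≤ ‖η‖ then ENNReal.ofReal ((2 ^ j / ‖η‖) ^ δ) else 0

lemma measurable_tailWeight (δ : ℝ) (j : ℤ) : Measurable (tailWeight δ j) := by
  refine Measurable.ite (measurableSet_le measurable_const measurable_norm) ?_ measurable_const
  fun_prop

lemma exists_tsum_tailWeight_sq_le {δ : ℝ} (hδ : 0 < δ) :
    ∃ K : ℝ, 0 < K ∧ ∀ η, ∑' j : ℤ, tailWeight δ j η ^ 2 ≤ ENNReal.ofReal K := by
  set q : ℝ := 2 ^ (-(2 * δ)) with hq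
  have hq0 : 0 < q := by positivity
  have hq1 : q < 1 := Real.rpow_lt_one_of_one_lt_of_neg one_lt_two (by linarith)
  have hsum : Summable fun n : ℕ => q ^ n := summable_geometric_of_lt_one hq0.le hq1
  have hsumZ : Summable fun n : ℤ => q ^ n.natAbs :=
    Summable.of_nat_of_neg (by simpa using hsum) (by simpa using hsum)
  set A : ℝ := 16 ^ (2 * δ) with hA
  have hA0 : 0 < A := by positivity
  refine ⟨A * ∑' n : ℤ, q ^ n.natAbs + 1, by positivity, fun η => ?_⟩
  rcases eq_or_ne η 0 with rfl | hη
  · have : ∀ j : ℤ, tailWeight δ j 0 = 0 := fun j => by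
      rw [tailWeight, if_neg]; rw [norm_zero, not_le]; positivity
    simp [this]
  have hη0 : 0 < ‖η‖ := norm_pos_iff.2 hη
  obtain ⟨n, hn1, hn2⟩ := exists_mem_Ico_zpow hη0 one_lt_two
  have hterm : ∀ j : ℤ, tailWeight δ j η ^ 2 ≤ ENNReal.ofReal (A * q ^ (j - n).natAbs) := by
    intro j
    rw [tailWeight]
    split_ifs with h
    · rw [← ENNReal.ofReal_pow (by positivity)]
      refine ENNReal.ofReal_le_ofReal ?_
      have hj : j ≤ n + 2 := by
        have h1 : (2 : ℝ) ^ j < 2 ^ (n + 3) := by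
          rw [zpow_add₀ two_ne_zero] at hn2 ⊢
          norm_num at hn2 ⊢
          linarith
        have := (zpow_lt_zpow_iff_right₀ (one_lt_two (α := ℝ))).1 h1
        omega
      -- for `j ≤ n` the exponent is `n - j`; for `j ≤ n + 2` the constant `A` absorbs the excess
      have hle : (2 : ℝ) ^ j / ‖η‖ ≤ 16 * 2 ^ (-((j - n).natAbs : ℝ)) := by
        rw [div_le_iff₀ hη0]
        have h3 : (2 : ℝ) ^ j ≤ 16 * 2 ^ (-((j - n).natAbs : ℝ)) * 2 ^ n := by
          rw [← Real.rpow_intCast, ← Real.rpow_intCast, mul_assoc, ← Real.rpow_add two_pos,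
            show (16 : ℝ) = 2 ^ (4 : ℝ) by norm_num, ← Real.rpow_add two_pos]
          refine Real.rpow_le_rpow_of_exponent_le one_le_two ?_
          have : (j : ℤ) ≤ 4 + (-((j - n).natAbs : ℤ) + n) := by omega
          exact_mod_cast this
        exact h3.trans (by gcongr)
      calc _ ≤ ((16 * (2 : ℝ) ^ (-((j - n).natAbs : ℝ))) ^ δ) ^ 2 := by gcongr
        _ = _ := by
          rw [← Real.rpow_mul_natCast (by positivity),
            Real.mul_rpow (by norm_num) (by positivity), hA, hq,
            ← Real.rpow_mul_natCast two_pos.le, ← Real.rpow_mul two_pos.le]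
          push_cast
          congr 2 <;> ring
    · simp
  calc _ ≤ ∑' j : ℤ, ENNReal.ofReal (A * q ^ (j - n).natAbs) := ENNReal.tsum_le_tsum hterm
    _ = ∑' j : ℤ, ENNReal.ofReal (A * q ^ j.natAbs) :=
      (Equiv.subRight n).tsum_eq fun j : ℤ => ENNReal.ofReal (A * q ^ j.natAbs)
    _ = ENNReal.ofReal (A * ∑' j : ℤ, q ^ j.natAbs) := by
      rw [← tsum_mul_left, ENNReal.ofReal_tsum_of_nonneg (fun _ => by positivity)
        (hsumZ.mul_left A)]
    _ ≤ _ := ENNReal.ofReal_le_ofReal (by linarith)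

/-- The `L²` norm of the dyadic tail of `u` of index `j`. -/
noncomputable def tailNorm (δ : ℝ) (j : ℤ) (u : Plane → ℝ≥0∞) : ℝ≥0∞ :=
  eLpNorm (fun η => tailWeight δ j η * u η) 2 volume

lemma tsum_tailNorm_sq_le {δ K : ℝ} (hK : ∀ η, ∑' j : ℤ, tailWeight δ j η ^ 2 ≤ ENNReal.ofReal K)
    {u : Plane → ℝ≥0∞} (hu : AEMeasurable u volume) :
    ∑' j : ℤ, tailNorm δ j u ^ 2 ≤ ENNReal.ofReal K * eLpNorm u 2 volume ^ 2 := by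
  simp only [tailNorm, eLpNorm_two_sq]
  have hm : ∀ j, AEMeasurable (fun η => (tailWeight δ j η * u η) ^ 2) volume :=
    fun j => ((measurable_tailWeight δ j).aemeasurable.mul hu).pow_const 2
  rw [← lintegral_tsum hm,
    ← lintegral_const_mul' _ _ ENNReal.ofReal_ne_top]
  refine lintegral_mono fun η => ?_
  simp only [mul_pow]
  rw [ENNReal.tsum_mul_right]
  gcongr
  exact hK η

/-! ### The three frequency interactions -/

/-- The density `|ξ|^σ w(|ξ|) u(ξ)`, whose `L²` norm is the homogeneous weighted Sobolev norm. -/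
noncomputable def weighted (σ : ℝ) (w : ℝ → ℝ) (u : Plane → ℝ≥0∞) (ξ : Plane) : ℝ≥0∞ :=
  ENNReal.ofReal (‖ξ‖ ^ σ * w ‖ξ‖) * u ξ

lemma MemMW.measurable_comp_norm {w : ℝ → ℝ} (hw : MemMW w) : Measurable fun ξ : Plane => w ‖ξ‖ :=
  (hw.continuousOn.comp_continuous continuous_norm fun ξ => norm_nonneg ξ).measurable

lemma aemeasurable_weighted {w : ℝ → ℝ} (hw : MemMW w) (σ : ℝ) {u : Plane → ℝ≥0∞}
    (hu : AEMeasurable u volume) : AEMeasurable (weighted σ w u) volume :=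
  (((measurable_norm.pow_const σ).mul hw.measurable_comp_norm).ennreal_ofReal.aemeasurable).mul hu

/-- The closed annulus `2 ^ j / 4 ≤ |ξ| ≤ 4 * 2 ^ j`. -/
def wideAnnulus (j : ℤ) : Set Plane := {ξ | (2 : ℝ) ^ j / 4 ≤ ‖ξ‖ ∧ ‖ξ‖ ≤ 4 * 2 ^ j}

lemma measurableSet_wideAnnulus (j : ℤ) : MeasurableSet (wideAnnulus j) :=
  (measurableSet_le measurable_const measurable_norm).inter
    (measurableSet_le measurable_norm measurable_const)

lemma measurableSet_dyadicAnnulus (j : ℤ) : MeasurableSet (dyadicAnnulus j) :=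
  (measurableSet_lt measurable_const measurable_norm).inter
    (measurableSet_lt measurable_norm measurable_const)

/-- On one annulus the weights are constants up to bounded factors. -/
lemma exists_eLpNorm_indicator_wideAnnulus_le {K : ℝ} {w : ℝ → ℝ} (hw : IsLogLipschitz K w)
    (τ : ℝ) {δ : ℝ} (hδ : 0 < δ) :
    ∃ C : ℝ, 0 < C ∧ ∀ (j : ℤ) (v : Plane → ℝ≥0∞),
      eLpNorm ((wideAnnulus j).indicator v) 2 volume ≤
        ENNReal.ofReal (C * ((2 : ℝ) ^ j) ^ (-τ) * (1 / w (2 ^ j))) * tailNorm δ j (weighted τ w v) := by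
  have hq := (IsLogLipschitz.rpow τ).mul hw
  refine ⟨4 ^ (|τ| + K) * 4 ^ δ, by positivity, fun j v => ?_⟩
  have h2 : (0 : ℝ) < 2 ^ j := by positivity
  have hw2 := hw.1 _ h2
  refine eLpNorm_le_mul_eLpNorm_of_ae_le_mul' (Filter.Eventually.of_forall fun η => ?_) 2
  simp only [enorm_eq_self]
  by_cases hη : η ∈ wideAnnulus j
  · obtain ⟨h1, h1'⟩ := hη
    have h0 : 0 < ‖η‖ := by linarith
    rw [indicator_of_mem (show η ∈ wideAnnulus j from ⟨h1, h1'⟩), tailWeight, if_pos h1, weighted,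
      ← mul_assoc, ← mul_assoc]
    refine le_mul_of_one_le_left zero_le ?_
    change 1 ≤ ENNReal.ofReal _ * _ * _
    rw [← ENNReal.ofReal_mul (by positivity), ← ENNReal.ofReal_mul (by positivity),
      ENNReal.one_le_ofReal]
    have e1 := hq.le_rpow_mul (R := 4) h2 h0 (by norm_num) (by linarith) h1'
    have e2 : (1 : ℝ) ≤ 4 ^ δ * (2 ^ j / ‖η‖) ^ δ := by
      rw [← Real.mul_rpow (by norm_num) (by positivity)]
      refine Real.one_le_rpow ?_ hδ.le
      rw [← mul_div_assoc, le_div_iff₀ h0]; linarith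
    have e3 : ((2 : ℝ) ^ j) ^ (-τ) * (1 / w (2 ^ j)) * ((2 ^ j) ^ τ * w (2 ^ j)) = 1 := by
      rw [Real.rpow_neg h2.le]
      have := Real.rpow_pos_of_pos h2 τ
      field_simp
    have hqη := hq.1 _ h0
    calc (1 : ℝ) = ((2 : ℝ) ^ j) ^ (-τ) * (1 / w (2 ^ j)) * ((2 ^ j) ^ τ * w (2 ^ j)) := e3.symm
      _ ≤ ((2 : ℝ) ^ j) ^ (-τ) * (1 / w (2 ^ j)) * (4 ^ (|τ| + K) * (‖η‖ ^ τ * w ‖η‖)) := by gcongr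
      _ ≤ ((2 : ℝ) ^ j) ^ (-τ) * (1 / w (2 ^ j)) * (4 ^ (|τ| + K) * (‖η‖ ^ τ * w ‖η‖)) *
            (4 ^ δ * (2 ^ j / ‖η‖) ^ δ) := le_mul_of_one_le_right (by positivity) e2
      _ = _ := by ring
  · rw [indicator_of_notMem hη]; exact zero_le

/-- Low-high interaction: Bernstein's inequality for the low-frequency factor. -/
lemma exists_trilinear_lowHigh_le {s : ℝ} (hs : s ≤ 1) {w : ℝ → ℝ} (hwc : ContinuousOn w (Ioi 0))
    (hw : ∀ t, 0 < t → 0 < w t) {K : ℝ} {w' : ℝ → ℝ} (hw' : IsLogLipschitz K w') (τ : ℝ)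
    {δ : ℝ} (hδ : 0 < δ) :
    ∃ C : ℝ, 0 < C ∧ ∀ (j : ℤ) (u v h : Plane → ℝ≥0∞), AEMeasurable u volume →
      AEMeasurable v volume → AEMeasurable h volume →
      trilinear ((Metric.ball 0 (2 ^ j)).indicator u) ((wideAnnulus j).indicator v) h ≤
        ENNReal.ofReal (C * ((2 : ℝ) ^ j) ^ (1 - s - τ)) *
          (ENNReal.ofReal (1 / w' (2 ^ j)) * lowFreqIntegral s w (2 ^ j) ^ (1 / 2 : ℝ) *
            (lowNorm s w u * tailNorm δ j (weighted τ w' v))) * eLpNorm h 2 volume := by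
  obtain ⟨C, hC, hCb⟩ := exists_eLpNorm_indicator_wideAnnulus_le hw' τ hδ
  set S := (volume : Measure Plane).toSphere univ ^ (1 / 2 : ℝ) with hS
  have hSt : S ≠ ∞ := ENNReal.rpow_ne_top_of_nonneg (by norm_num) (measure_ne_top _ _)
  refine ⟨(S.toReal + 1) * C, by positivity, fun j u v h hu hv hh => ?_⟩
  have h2 : (0 : ℝ) < 2 ^ j := by positivity
  have hw2 := hw'.1 _ h2
  have hSle : S ≤ ENNReal.ofReal (S.toReal + 1) := by
    conv_lhs => rw [← ENNReal.ofReal_toReal hSt]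
    exact ENNReal.ofReal_le_ofReal (by linarith)
  have e1 := lintegral_ball_le_lowNorm hs hwc hw hu h2
  rw [← lintegral_indicator measurableSet_ball] at e1
  refine (trilinear_le_one_two_two (hu.indicator measurableSet_ball)
    (hv.indicator (measurableSet_wideAnnulus j)) hh).trans ?_
  calc _ ≤ (S * ENNReal.ofReal (((2 : ℝ) ^ j) ^ (1 - s)) *
          lowFreqIntegral s w (2 ^ j) ^ (1 / 2 : ℝ) * lowNorm s w u) *
        (ENNReal.ofReal (C * ((2 : ℝ) ^ j) ^ (-τ) * (1 / w' (2 ^ j))) *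
          tailNorm δ j (weighted τ w' v)) * eLpNorm h 2 volume := by
        gcongr
        exact hCb j v
    _ ≤ (ENNReal.ofReal (S.toReal + 1) * ENNReal.ofReal (((2 : ℝ) ^ j) ^ (1 - s)) *
          lowFreqIntegral s w (2 ^ j) ^ (1 / 2 : ℝ) * lowNorm s w u) *
        (ENNReal.ofReal (C * ((2 : ℝ) ^ j) ^ (-τ) * (1 / w' (2 ^ j))) *
          tailNorm δ j (weighted τ w' v)) * eLpNorm h 2 volume := by gcongr
    _ = _ := by
        have e2 : ((2 : ℝ) ^ j) ^ (1 - s - τ) = ((2 : ℝ) ^ j) ^ (1 - s) * (2 ^ j) ^ (-τ) := by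
          rw [← Real.rpow_add h2]; congr 1
        have hS0 : 0 ≤ S.toReal + 1 := by positivity
        rw [e2, ENNReal.ofReal_mul (by positivity : 0 ≤ C * ((2 : ℝ) ^ j) ^ (-τ)),
          ENNReal.ofReal_mul hC.le, ENNReal.ofReal_mul (by positivity : 0 ≤ (S.toReal + 1) * C),
          ENNReal.ofReal_mul hS0, ENNReal.ofReal_mul (by positivity)]
        ring

lemma MemMW.exists_highHigh_le {w w' : ℝ → ℝ} (hw : MemMW w) (hw' : MemMW w') {s s' : ℝ}
    (hss' : 0 < s + s') :
    ∃ C : ℝ, 0 < C ∧ ∀ y τ t : ℝ, 0 < y → y / 4 ≤ τ → y / 4 ≤ t → τ ≤ 9 * t → t ≤ 9 * τ →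
      y ^ (s + s') * (w y * w' y) ≤
        C * ((τ ^ s * w τ) * ((y / t) ^ ((s + s') / 2) * (t ^ s' * w' t))) := by
  obtain ⟨K, hK⟩ := hw.isLogLipschitz
  have hq := (IsLogLipschitz.rpow s).mul hK
  obtain ⟨A, hA0, hA⟩ := hw.exists_le_rpow_mul (ε := (s + s') / 4) (by linarith)
  obtain ⟨A', hA0', hA'⟩ := hw'.exists_le_rpow_mul (ε := (s + s') / 4) (by linarith)
  refine ⟨9 ^ (|s| + K) * A * A', by positivity, fun y τ t hy hτ ht h1 h2 => ?_⟩
  have hτ0 : 0 < τ := by linarith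
  have ht0 : 0 < t := by linarith
  have hwt := hw.pos ht0.le
  have hwτ := hw.pos hτ0.le
  have hwt' := hw'.pos ht0.le
  have hwy' := hw'.pos hy.le
  have e0 := hq.le_rpow_mul (R := 9) ht0 hτ0 (by norm_num) h2 h1
  have e1 := hA y t hy ht
  have e2 := hA' y t hy ht
  -- half of the decay `(y / t) ^ (s + s')` pays for the growth of the two weights
  have e3 : y ^ (s + s') * ((t / y) ^ ((s + s') / 4) * (t / y) ^ ((s + s') / 4)) =
      (y / t) ^ ((s + s') / 2) * (t ^ s * t ^ s') := by
    have p : ∀ a b : ℝ, 0 < a → 0 < b → (a / b) ^ ((s + s') / 2) =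
        a ^ ((s + s') / 2) / b ^ ((s + s') / 2) := fun a b ha hb => Real.div_rpow ha.le hb.le _
    rw [← Real.rpow_add (by positivity), ← Real.rpow_add ht0,
      show (s + s') / 4 + (s + s') / 4 = (s + s') / 2 by ring, p _ _ ht0 hy, p _ _ hy ht0,
      show s + s' = (s + s') / 2 + (s + s') / 2 by ring, Real.rpow_add hy, Real.rpow_add ht0,
      show ((s + s') / 2 + (s + s') / 2) / 2 = (s + s') / 2 by ring]
    have := Real.rpow_pos_of_pos hy ((s + s') / 2)
    have := Real.rpow_pos_of_pos ht0 ((s + s') / 2)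
    field_simp
  calc _ ≤ y ^ (s + s') * ((A * (t / y) ^ ((s + s') / 4) * w t) *
        (A' * (t / y) ^ ((s + s') / 4) * w' t)) := by
        have := hw.pos hy.le
        gcongr
    _ = A * A' * (y ^ (s + s') * ((t / y) ^ ((s + s') / 4) * (t / y) ^ ((s + s') / 4))) *
          (w t * w' t) := by ring
    _ = A * A' * ((y / t) ^ ((s + s') / 2) * (t ^ s' * w' t)) * (t ^ s * w t) := by rw [e3]; ring
    _ ≤ A * A' * ((y / t) ^ ((s + s') / 2) * (t ^ s' * w' t)) *
          (9 ^ (|s| + K) * (τ ^ s * w τ)) := by gcongr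
    _ = _ := by ring

lemma exists_lintegral_dyadicAnnulus_le :
    ∃ C : ℝ, 0 < C ∧ ∀ (j : ℤ) (h : Plane → ℝ≥0∞), AEMeasurable h volume →
      (∀ ξ, ξ ∉ dyadicAnnulus j → h ξ = 0) →
      ∫⁻ ξ, h ξ ≤ ENNReal.ofReal (C * (2 : ℝ) ^ j) * eLpNorm h 2 volume := by
  refine ⟨2 * Real.pi ^ (1 / 2 : ℝ), by positivity, fun j h hh hsupp => ?_⟩
  have h2 : (0 : ℝ) < 2 ^ j := by positivity
  set B : Set Plane := Metric.ball 0 (2 * 2 ^ j) with hB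
  have e : ∀ ξ, h ξ = B.indicator (fun _ => (1 : ℝ≥0∞)) ξ * h ξ := by
    intro ξ
    by_cases hξ : ξ ∈ B
    · rw [indicator_of_mem hξ, one_mul]
    · rw [hsupp ξ (fun h' => hξ (by simpa [hB] using (dyadicAnnulus_bounds h').2)), mul_zero]
  calc ∫⁻ ξ, h ξ = ∫⁻ ξ, B.indicator (fun _ => (1 : ℝ≥0∞)) ξ * h ξ :=
        lintegral_congr e
    _ ≤ eLpNorm (B.indicator fun _ => (1 : ℝ≥0∞)) 2 volume * eLpNorm h 2 volume :=
        lintegral_mul_le_eLpNorm_two (aemeasurable_const.indicator measurableSet_ball) hh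
    _ = _ := by
        rw [eLpNorm_indicator_const measurableSet_ball two_ne_zero ENNReal.ofNat_ne_top,
          EuclideanSpace.volume_ball_fin_two, ← ENNReal.ofReal_pow (by positivity),
          ← ENNReal.ofReal_mul (by positivity), ENNReal.toReal_ofNat,
          ENNReal.ofReal_rpow_of_nonneg (by positivity) (by norm_num),
          Real.mul_rpow (by positivity) Real.pi_pos.le, ← Real.sqrt_eq_rpow,
          Real.sqrt_sq (by positivity), enorm_eq_self, one_mul]
        congr 2; ring

/-- High-high interaction: here `s + s' > 0` yields the summability of the dyadic tail, and the
Bernstein factor `2 ^ j` falls on the test function. -/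
lemma MemMW.exists_trilinear_highHigh_le {w w' : ℝ → ℝ} (hw : MemMW w) (hw' : MemMW w') {s s' : ℝ}
    (hss' : 0 < s + s') :
    ∃ C : ℝ, 0 < C ∧ ∀ (j : ℤ) (u v h : Plane → ℝ≥0∞), AEMeasurable u volume →
      AEMeasurable v volume → AEMeasurable h volume → (∀ ξ, ξ ∉ dyadicAnnulus j → h ξ = 0) →
      trilinear ({ζ | (2 : ℝ) ^ j / 4 ≤ ‖ζ‖}.indicator u) ({η | (2 : ℝ) ^ j / 4 ≤ ‖η‖}.indicator v) h ≤
        ENNReal.ofReal (C * ((2 : ℝ) ^ j) ^ (1 - s - s')) *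
          (ENNReal.ofReal (1 / (w (2 ^ j) * w' (2 ^ j))) * (eLpNorm (weighted s w u) 2 volume *
            tailNorm ((s + s') / 2) j (weighted s' w' v))) * eLpNorm h 2 volume := by
  obtain ⟨C, hC, hCb⟩ := hw.exists_highHigh_le hw' hss'
  obtain ⟨C', hC', hCb'⟩ := exists_lintegral_dyadicAnnulus_le
  refine ⟨C * C', by positivity, fun j u v h hu hv hh hsupp => ?_⟩
  have h2 : (0 : ℝ) < 2 ^ j := by positivity
  have hw2 := hw.pos h2.le
  have hw2' := hw'.pos h2.le
  set D : ℝ := C * ((2 : ℝ) ^ j) ^ (-(s + s')) * (1 / (w (2 ^ j) * w' (2 ^ j))) with hD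
  have hD0 : 0 < D := by positivity
  set V : Plane → ℝ≥0∞ := fun η => tailWeight ((s + s') / 2) j η * weighted s' w' v η with hV
  have hU := aemeasurable_weighted hw s hu
  have hVm : AEMeasurable V volume :=
    (measurable_tailWeight _ j).aemeasurable.mul (aemeasurable_weighted hw' s' hv)
  have hpt : ∀ ξ η, {ζ : Plane | (2 : ℝ) ^ j / 4 ≤ ‖ζ‖}.indicator u (ξ - η) *
      {η : Plane | (2 : ℝ) ^ j / 4 ≤ ‖η‖}.indicator v η * h ξ ≤
      ENNReal.ofReal D * (weighted s w u (ξ - η) * V η * h ξ) := by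
    intro ξ η
    by_cases hξ : ξ ∈ dyadicAnnulus j
    swap
    · simp [hsupp ξ hξ]
    by_cases hζ : (2 : ℝ) ^ j / 4 ≤ ‖ξ - η‖
    swap
    · rw [indicator_of_notMem (show ξ - η ∉ {ζ : Plane | (2 : ℝ) ^ j / 4 ≤ ‖ζ‖} from hζ)]; simp
    by_cases hη : (2 : ℝ) ^ j / 4 ≤ ‖η‖
    swap
    · rw [indicator_of_notMem (show η ∉ {ζ : Plane | (2 : ℝ) ^ j / 4 ≤ ‖ζ‖} from hη)]; simp
    rw [indicator_of_mem (show ξ - η ∈ {ζ : Plane | (2 : ℝ) ^ j / 4 ≤ ‖ζ‖} from hζ),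
      indicator_of_mem (show η ∈ {ζ : Plane | (2 : ℝ) ^ j / 4 ≤ ‖ζ‖} from hη)]
    have hb := dyadicAnnulus_bounds hξ
    have n1 : ‖ξ - η‖ ≤ ‖ξ‖ + ‖η‖ := norm_sub_le _ _
    have n2 : ‖η‖ ≤ ‖ξ‖ + ‖ξ - η‖ := by
      simpa using norm_sub_le ξ (ξ - η)
    have hz0 : 0 < ‖ξ - η‖ := by linarith
    have he0 : 0 < ‖η‖ := by linarith
    have hwz := hw.pos hz0.le
    have hwe := hw'.pos he0.le
    have key := hCb (2 ^ j) ‖ξ - η‖ ‖η‖ h2 hζ hη (by linarith) (by linarith)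
    rw [hV]
    simp only [weighted, tailWeight, if_pos hη]
    have hone : (1 : ℝ≥0∞) ≤ ENNReal.ofReal D * (ENNReal.ofReal (‖ξ - η‖ ^ s * w ‖ξ - η‖) *
        (ENNReal.ofReal ((2 ^ j / ‖η‖) ^ ((s + s') / 2)) *
          ENNReal.ofReal (‖η‖ ^ s' * w' ‖η‖))) := by
      rw [← ENNReal.ofReal_mul (by positivity), ← ENNReal.ofReal_mul (by positivity),
        ← ENNReal.ofReal_mul hD0.le, ENNReal.one_le_ofReal, hD, Real.rpow_neg h2.le]
      have hp := Real.rpow_pos_of_pos h2 (s + s')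
      have e : C * ((2 ^ j : ℝ) ^ (s + s'))⁻¹ * (1 / (w (2 ^ j) * w' (2 ^ j))) =
          C / ((2 ^ j : ℝ) ^ (s + s') * (w (2 ^ j) * w' (2 ^ j))) := by field_simp
      rw [e, div_mul_eq_mul_div, le_div_iff₀ (by positivity), one_mul]
      exact key
    calc _ = 1 * (u (ξ - η) * v η * h ξ) := (one_mul _).symm
      _ ≤ _ := mul_le_mul_left hone _
      _ = _ := by ring
  calc _ ≤ ENNReal.ofReal D * trilinear (weighted s w u) V h := by
        rw [trilinear, trilinear, ← lintegral_const_mul' _ _ ENNReal.ofReal_ne_top]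
        refine lintegral_mono fun ξ => ?_
        rw [← lintegral_const_mul' _ _ ENNReal.ofReal_ne_top]
        exact lintegral_mono fun η => hpt ξ η
    _ ≤ ENNReal.ofReal D * (eLpNorm (weighted s w u) 2 volume * eLpNorm V 2 volume *
          (ENNReal.ofReal (C' * (2 : ℝ) ^ j) * eLpNorm h 2 volume)) := by
        gcongr
        refine (trilinear_le_two_two_one hU hVm hh).trans ?_
        gcongr
        exact hCb' j h hh hsupp
    _ = _ := by
        have e2 : ((2 : ℝ) ^ j) ^ (1 - s - s') = 2 ^ j * ((2 : ℝ) ^ j) ^ (-(s + s')) := by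
          rw [show 1 - s - s' = 1 + -(s + s') by ring, Real.rpow_add h2, Real.rpow_one]
        rw [e2, hD, ENNReal.ofReal_mul (by positivity : 0 ≤ C * ((2 : ℝ) ^ j) ^ (-(s + s'))),
          ENNReal.ofReal_mul hC.le, ENNReal.ofReal_mul hC'.le,
          ENNReal.ofReal_mul (by positivity : 0 ≤ C * C'), ENNReal.ofReal_mul hC.le,
          ENNReal.ofReal_mul h2.le, tailNorm]
        ring

/-- If `ξ` lies in the annulus of index `j` and `ξ = ζ + η`, then either one of the two input
frequencies is small and the other is comparable to `2 ^ j`, or both are at least `2 ^ j / 4`. -/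
lemma trilinear_le_add_add {j : ℤ} {u v h : Plane → ℝ≥0∞} (hu : AEMeasurable u volume)
    (hv : AEMeasurable v volume) (hh : AEMeasurable h volume)
    (hsupp : ∀ ξ, ξ ∉ dyadicAnnulus j → h ξ = 0) :
    trilinear u v h ≤
      trilinear ((Metric.ball 0 (2 ^ j)).indicator u) ((wideAnnulus j).indicator v) h +
      trilinear ((wideAnnulus j).indicator u) ((Metric.ball 0 (2 ^ j)).indicator v) h +
      trilinear ({ζ | (2 : ℝ) ^ j / 4 ≤ ‖ζ‖}.indicator u)
        ({η | (2 : ℝ) ^ j / 4 ≤ ‖η‖}.indicator v) h := by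
  have h2 : (0 : ℝ) < 2 ^ j := by positivity
  have hB : MeasurableSet (Metric.ball (0 : Plane) (2 ^ j)) := measurableSet_ball
  have hW := measurableSet_wideAnnulus j
  have hT : MeasurableSet {ζ : Plane | (2 : ℝ) ^ j / 4 ≤ ‖ζ‖} :=
    measurableSet_le measurable_const measurable_norm
  have m1 := aemeasurable_trilinear (hu.indicator hB) (hv.indicator hW) hh
  have m2 := aemeasurable_trilinear (hu.indicator hW) (hv.indicator hB) hh
  rw [trilinear_eq_lintegral_prod hu hv hh,
    trilinear_eq_lintegral_prod (hu.indicator hB) (hv.indicator hW) hh,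
    trilinear_eq_lintegral_prod (hu.indicator hW) (hv.indicator hB) hh,
    trilinear_eq_lintegral_prod (hu.indicator hT) (hv.indicator hT) hh,
    add_assoc, ← lintegral_add_left' m2, ← lintegral_add_left' m1]
  refine lintegral_mono fun p => ?_
  obtain ⟨ξ, η⟩ := p
  by_cases hξ : ξ ∈ dyadicAnnulus j
  swap
  · simp [hsupp ξ hξ]
  have hb := dyadicAnnulus_bounds hξ
  simp only
  have n1 : ‖ξ - η‖ ≤ ‖ξ‖ + ‖η‖ := norm_sub_le _ _
  have n2 : ‖η‖ ≤ ‖ξ‖ + ‖ξ - η‖ := by simpa using norm_sub_le ξ (ξ - η)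
  have n3 : ‖ξ‖ ≤ ‖ξ - η‖ + ‖η‖ := by simpa using norm_add_le (ξ - η) η
  rcases lt_or_ge ‖ξ - η‖ ((2 : ℝ) ^ j / 4) with hz | hz
  · rw [indicator_of_mem (show ξ - η ∈ Metric.ball (0 : Plane) (2 ^ j) by
        rw [mem_ball_zero_iff]; linarith),
      indicator_of_mem (show η ∈ wideAnnulus j from ⟨by linarith, by linarith⟩)]
    exact le_self_add
  rcases lt_or_ge ‖η‖ ((2 : ℝ) ^ j / 4) with he | he
  · rw [indicator_of_mem (show ξ - η ∈ wideAnnulus j from ⟨by linarith, by linarith⟩),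
      indicator_of_mem (show η ∈ Metric.ball (0 : Plane) (2 ^ j) by
        rw [mem_ball_zero_iff]; linarith)]
    exact le_self_add.trans le_add_self
  · rw [indicator_of_mem (show ξ - η ∈ {ζ : Plane | (2 : ℝ) ^ j / 4 ≤ ‖ζ‖} from hz),
      indicator_of_mem (show η ∈ {ζ : Plane | (2 : ℝ) ^ j / 4 ≤ ‖ζ‖} from he)]
    exact le_add_self.trans le_add_self

/-- The trilinear paraproduct estimate at output frequency `2 ^ j`. -/
lemma exists_trilinear_le {s s' : ℝ} (hs : s ≤ 1) (hs' : s' ≤ 1) (hss' : 0 < s + s')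
    {ω₁ ω₂ ω₃ ω₁' ω₂' ω₃' : ℝ → ℝ} (hω₁ : MemMW ω₁) (hω₂ : MemMW ω₂) (hω₃ : MemMW ω₃)
    (hω₁' : MemMW ω₁') (hω₂' : MemMW ω₂') (hω₃' : MemMW ω₃') :
    ∃ C : ℝ, 0 < C ∧ ∀ (j : ℤ) (u v h : Plane → ℝ≥0∞), AEMeasurable u volume →
      AEMeasurable v volume → AEMeasurable h volume → (∀ ξ, ξ ∉ dyadicAnnulus j → h ξ = 0) →
      trilinear u v h ≤ ENNReal.ofReal (C * ((2 : ℝ) ^ j) ^ (1 - s - s')) *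
        (ENNReal.ofReal (1 / ω₁' (2 ^ j)) * lowFreqIntegral s ω₁ (2 ^ j) ^ (1 / 2 : ℝ) *
            (lowNorm s ω₁ u * tailNorm ((s + s') / 2) j (weighted s' ω₁' v)) +
          ENNReal.ofReal (1 / ω₂' (2 ^ j)) * lowFreqIntegral s' ω₂ (2 ^ j) ^ (1 / 2 : ℝ) *
            (lowNorm s' ω₂ v * tailNorm ((s + s') / 2) j (weighted s ω₂' u)) +
          ENNReal.ofReal (1 / (ω₃ (2 ^ j) * ω₃' (2 ^ j))) * (eLpNorm (weighted s ω₃ u) 2 volume *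
            tailNorm ((s + s') / 2) j (weighted s' ω₃' v))) * eLpNorm h 2 volume := by
  obtain ⟨K₁, hK₁⟩ := hω₁'.isLogLipschitz
  obtain ⟨K₂, hK₂⟩ := hω₂'.isLogLipschitz
  have hδ : 0 < (s + s') / 2 := by linarith
  obtain ⟨C₁, h₁, hC₁⟩ := exists_trilinear_lowHigh_le hs
    (hω₁.continuousOn.mono Ioi_subset_Ici_self) (fun t ht => hω₁.pos (le_of_lt ht)) hK₁ s' hδ
  obtain ⟨C₂, h₂, hC₂⟩ := exists_trilinear_lowHigh_le hs'
    (hω₂.continuousOn.mono Ioi_subset_Ici_self) (fun t ht => hω₂.pos (le_of_lt ht)) hK₂ s hδ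
  obtain ⟨C₃, h₃, hC₃⟩ := hω₃.exists_trilinear_highHigh_le hω₃' hss'
  refine ⟨C₁ + C₂ + C₃, by positivity, fun j u v h hu hv hh hsupp => ?_⟩
  refine (trilinear_le_add_add hu hv hh hsupp).trans ?_
  have e₁ := hC₁ j u v h hu hv hh
  have e₂ := hC₂ j v u h hv hu hh
  rw [trilinear_comm, show 1 - s' - s = 1 - s - s' by ring] at e₂
  have e₃ := hC₃ j u v h hu hv hh hsupp
  refine (add_le_add (add_le_add e₁ e₂) e₃).trans ?_
  rw [mul_add, mul_add, add_mul, add_mul]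
  gcongr <;> linarith

/-! ### Convergence of the convolutions and of the pairings -/

section

variable {F G : Plane → ℂ}

lemma aestronglyMeasurable_product_integrand (hF : AEStronglyMeasurable F volume)
    (hG : AEStronglyMeasurable G volume) :
    AEStronglyMeasurable (fun p : Plane × Plane => F (p.1 - p.2) * G p.2)
      ((volume : Measure Plane).prod volume) :=
  (hF.comp_quasiMeasurePreserving
    (quasiMeasurePreserving_sub_of_right_invariant (volume : Measure Plane) volume)).mul hG.comp_snd

lemma aestronglyMeasurable_product_integrand_snd (hF : AEStronglyMeasurable F volume)
    (hG : AEStronglyMeasurable G volume) (ξ : Plane) :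
    AEStronglyMeasurable (fun η => F (ξ - η) * G η) volume :=
  (hF.comp_quasiMeasurePreserving
    (quasiMeasurePreserving_sub_left_of_right_invariant volume ξ)).mul hG

lemma exists_mem_dyadicAnnulus {ξ : Plane} (hξ : ξ ≠ 0) : ∃ j, ξ ∈ dyadicAnnulus j := by
  obtain ⟨n, h1, h2⟩ := exists_mem_Ico_zpow (norm_pos_iff.2 hξ) one_lt_two
  exact ⟨n, (zpow_lt_zpow_right₀ one_lt_two (by omega)).trans_le h1, h2⟩

/-- A product exists as soon as its absolute integrals over all dyadic annuli are finite. -/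
lemma productExists_of_trilinear_ne_top (hF : AEStronglyMeasurable F volume)
    (hG : AEStronglyMeasurable G volume)
    (hfin : ∀ j, trilinear (‖F ·‖ₑ) (‖G ·‖ₑ) ((dyadicAnnulus j).indicator 1) ≠ ∞) :
    ProductExists F G := by
  have h0 : ∀ᵐ ξ : Plane, ξ ≠ 0 := Measure.ae_ne volume 0
  have h1 : ∀ᵐ ξ : Plane, ∀ j : ℤ,
      ∫⁻ η, ‖F (ξ - η)‖ₑ * ‖G η‖ₑ * (dyadicAnnulus j).indicator 1 ξ < ∞ := by
    rw [ae_all_iff]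
    intro j
    refine ae_lt_top' ?_ (hfin j)
    exact (aemeasurable_trilinear hF.enorm hG.enorm
      (aemeasurable_one.indicator (measurableSet_dyadicAnnulus j))).lintegral_prod_right'
  filter_upwards [h0, h1] with ξ hξ hj
  obtain ⟨j, hmem⟩ := exists_mem_dyadicAnnulus hξ
  refine ⟨aestronglyMeasurable_product_integrand_snd hF hG ξ, ?_⟩
  have := hj j
  simp only [indicator_of_mem hmem, Pi.one_apply, mul_one] at this
  simpa only [HasFiniteIntegral, enorm_mul] using this

lemma integrable_productHat_mul {H : Plane → ℂ} (hF : AEStronglyMeasurable F volume)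
    (hG : AEStronglyMeasurable G volume) (hH : AEStronglyMeasurable H volume)
    (hfin : trilinear (‖F ·‖ₑ) (‖G ·‖ₑ) (‖H ·‖ₑ) ≠ ∞) :
    Integrable (fun ξ => productHat F G ξ * (starRingEnd ℂ) (H ξ)) volume := by
  have hm : AEStronglyMeasurable (productHat F G) volume :=
    (aestronglyMeasurable_product_integrand hF hG).integral_prod_right'
  refine ⟨hm.mul (Complex.continuous_conj.comp_aestronglyMeasurable hH), ?_⟩
  refine lt_of_le_of_lt (lintegral_mono fun ξ => ?_) hfin.lt_top
  have hy : ‖H ξ‖ₑ ≠ ∞ := enorm_ne_top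
  rw [enorm_mul, lintegral_mul_const' _ _ hy]
  gcongr
  · refine (enorm_integral_le_lintegral_enorm _).trans_eq ?_
    simp only [enorm_mul]
  · exact le_of_eq (by simp [enorm_eq_nnnorm])

variable {a H : Plane → ℂ}

lemma trilinear_mul_left_le {M : ℝ} (haM : ∀ ξ, ‖a ξ‖ ≤ M) (h : Plane → ℝ≥0∞) :
    trilinear (fun ζ => ‖(a * F) ζ‖ₑ) (‖G ·‖ₑ) h ≤
      ENNReal.ofReal M * trilinear (‖F ·‖ₑ) (‖G ·‖ₑ) h := by
  rw [trilinear, trilinear, ← lintegral_const_mul' _ _ ENNReal.ofReal_ne_top]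
  refine lintegral_mono fun ξ => ?_
  rw [← lintegral_const_mul' _ _ ENNReal.ofReal_ne_top]
  refine lintegral_mono fun η => ?_
  simp only [Pi.mul_apply, enorm_mul]
  rw [mul_assoc, mul_assoc, mul_assoc, ← mul_assoc ‖F _‖ₑ]
  gcongr
  rw [← ofReal_norm]
  exact ENNReal.ofReal_le_ofReal (haM _)

/-- For a bounded multiplier everything reduces to the absolute convergence of the trilinear form
of the two densities and of the test function. -/
lemma commutatorPairingExists_of_trilinear {h : Lp ℂ 2 (volume : Measure Plane)}
    (hF : AEStronglyMeasurable F volume) (hG : AEStronglyMeasurable G volume)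
    (ha : AEStronglyMeasurable a volume) {M : ℝ} (haM : ∀ ξ, ‖a ξ‖ ≤ M)
    (hfin : ∀ j, trilinear (‖F ·‖ₑ) (‖G ·‖ₑ) ((dyadicAnnulus j).indicator 1) ≠ ∞)
    (hfin' : trilinear (‖F ·‖ₑ) (‖G ·‖ₑ) (fun ξ => ‖(𝓕 h : Lp ℂ 2 (volume : Measure Plane)) ξ‖ₑ) ≠ ∞) :
    CommutatorPairingExists a G F h := by
  have hH := Lp.aestronglyMeasurable (𝓕 h : Lp ℂ 2 (volume : Measure Plane))
  refine ⟨productExists_of_trilinear_ne_top hF hG hfin,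
    productExists_of_trilinear_ne_top (ha.mul hF) hG fun j => ?_, ?_,
    integrable_productHat_mul (ha.mul hF) hG hH ?_⟩
  · exact ne_top_of_le_ne_top (ENNReal.mul_ne_top ENNReal.ofReal_ne_top (hfin j))
      (trilinear_mul_left_le haM _)
  · have := (integrable_productHat_mul hF hG hH hfin').bdd_mul ha
      (Filter.Eventually.of_forall haM)
    refine this.congr (Filter.Eventually.of_forall fun ξ => ?_)
    simp only [Pi.mul_apply]
    ring
  · exact ne_top_of_le_ne_top (ENNReal.mul_ne_top ENNReal.ofReal_ne_top hfin')
      (trilinear_mul_left_le haM _)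

/-- The commutator pairing is controlled by the trilinear form once the difference of the symbol at
the output and at the input frequency is. -/
lemma enorm_fourierPairing_commutatorHat_le {h : Lp ℂ 2 (volume : Measure Plane)} {j : ℤ}
    (hh : SpectrallyLocalized h j) (hex : CommutatorPairingExists a G F h)
    {u v : Plane → ℝ≥0∞} {M : ℝ≥0∞} (hM : M ≠ ∞)
    (hb : ∀ ξ η, ξ ∈ dyadicAnnulus j →
      ‖a ξ - a (ξ - η)‖ₑ * (‖F (ξ - η)‖ₑ * ‖G η‖ₑ) ≤ M * (u (ξ - η) * v η)) :
    ‖fourierPairing (commutatorHat a G F) h‖ₑ ≤ M * trilinear u v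
      ((dyadicAnnulus j).indicator
        fun ξ => ‖(𝓕 h : Lp ℂ 2 (volume : Measure Plane)) ξ‖ₑ) := by
  refine (enorm_integral_le_lintegral_enorm _).trans ?_
  rw [trilinear, ← lintegral_const_mul' _ _ hM]
  refine lintegral_mono_ae ?_
  filter_upwards [hh, hex.1, hex.2.1] with ξ h1 h2 h3
  by_cases hξ : ξ ∈ dyadicAnnulus j
  swap
  · rw [h1 hξ]; simp
  rw [← lintegral_const_mul' _ _ hM]
  have h3' : Integrable (fun η => a (ξ - η) * F (ξ - η) * G η) volume := h3
  have e : commutatorHat a G F ξ = ∫ η, (a ξ - a (ξ - η)) * (F (ξ - η) * G η) := by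
    simp only [commutatorHat, Pi.sub_apply, Pi.mul_apply, productHat]
    rw [← integral_const_mul, ← integral_sub (h2.const_mul _) h3']
    refine integral_congr_ae (Filter.Eventually.of_forall fun η => ?_)
    simp only
    ring
  rw [enorm_mul, e]
  set y := ‖(𝓕 h : Lp ℂ 2 (volume : Measure Plane)) ξ‖ₑ with hy
  have hy' : ‖(starRingEnd ℂ) ((𝓕 h : Lp ℂ 2 (volume : Measure Plane)) ξ)‖ₑ = y := by
    simp [hy, enorm_eq_nnnorm]
  rw [hy', indicator_of_mem hξ]
  have hyt : y ≠ ∞ := enorm_ne_top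
  calc _ ≤ (∫⁻ η, ‖(a ξ - a (ξ - η)) * (F (ξ - η) * G η)‖ₑ) * y := by
        gcongr
        exact enorm_integral_le_lintegral_enorm _
    _ = ∫⁻ η, ‖(a ξ - a (ξ - η)) * (F (ξ - η) * G η)‖ₑ * y :=
        (lintegral_mul_const' _ _ hyt).symm
    _ ≤ _ := by
        refine lintegral_mono fun η => ?_
        rw [enorm_mul, enorm_mul, ← mul_assoc M]
        exact mul_le_mul_left (hb ξ η hξ) y

lemma trilinear_eq_zero_of_ae_eq_zero {u v : Plane → ℝ≥0∞}
    (huv : (∀ᵐ x : Plane, u x = 0) ∨ ∀ᵐ x : Plane, v x = 0) (h : Plane → ℝ≥0∞) :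
    trilinear u v h = 0 := by
  have key : ∀ u v : Plane → ℝ≥0∞, (∀ᵐ x : Plane, v x = 0) → trilinear u v h = 0 := by
    intro u v hv
    have : ∀ ξ, ∫⁻ η, u (ξ - η) * v η * h ξ = 0 := fun ξ => by
      rw [← lintegral_zero (μ := (volume : Measure Plane))]
      refine lintegral_congr_ae ?_
      filter_upwards [hv] with η hη
      simp [hη]
    simp [trilinear, this]
  rcases huv with hu | hv
  · rw [trilinear_comm]; exact key v u hu
  · exact key u v hv

lemma lintegral_indicator_ball_ne_top (hG : LocallyIntegrable G volume) (R : ℝ) :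
    ∫⁻ η, (Metric.ball (0 : Plane) R).indicator (‖G ·‖ₑ) η ≠ ∞ := by
  rw [lintegral_indicator measurableSet_ball]
  exact ((hG.integrableOn_isCompact (isCompact_closedBall 0 R)).mono_set
    Metric.ball_subset_closedBall).hasFiniteIntegral.ne

/-- The low frequencies of `G` are only known to be integrable, not to lie in the weighted space:
local integrability of `G` makes the convolution converge there. -/
lemma trilinear_ne_top_of_locallyIntegrable (hF : AEStronglyMeasurable F volume)
    (hG : LocallyIntegrable G volume)
    {u v h : Plane → ℝ≥0∞} (hu : AEMeasurable u volume) (hv : AEMeasurable v volume)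
    (hh : AEMeasurable h volume) {j : ℤ}
    (hsupp : ∀ ξ, ξ ∉ dyadicAnnulus j → h ξ = 0) (hFu : ∀ ζ, ‖F ζ‖ₑ ≤ u ζ)
    (hGv : ∀ η, ENNReal.ofReal ‖η‖ * ‖G η‖ₑ ≤ v η) (hfin : trilinear u v h ≠ ∞)
    (hwide : eLpNorm ((wideAnnulus j).indicator u) 2 volume ≠ ∞) (hh2 : eLpNorm h 2 volume ≠ ∞) :
    trilinear (‖F ·‖ₑ) (‖G ·‖ₑ) h ≠ ∞ := by
  have h2 : (0 : ℝ) < 2 ^ j := by positivity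
  have hB : MeasurableSet (Metric.ball (0 : Plane) (2 ^ j)) := measurableSet_ball
  have hG' := hG.aestronglyMeasurable
  have hu' := hu.indicator (measurableSet_wideAnnulus j)
  have hG'' := hG'.enorm.indicator hB
  have hsecond : trilinear ((wideAnnulus j).indicator u)
      ((Metric.ball 0 (2 ^ j)).indicator (‖G ·‖ₑ)) h ≠ ∞ :=
    ne_top_of_le_ne_top (ENNReal.mul_ne_top (ENNReal.mul_ne_top hwide
      (lintegral_indicator_ball_ne_top hG _)) hh2) (trilinear_le_two_one_two hu' hG'' hh)
  refine ne_top_of_le_ne_top (ENNReal.add_ne_top.2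
    ⟨ENNReal.mul_ne_top (ENNReal.ofReal_ne_top (r := 4 / 2 ^ j)) hfin, hsecond⟩) ?_
  rw [trilinear_eq_lintegral_prod hF.enorm hG'.enorm hh, trilinear_eq_lintegral_prod hu hv hh,
    trilinear_eq_lintegral_prod hu' hG'' hh, ← lintegral_const_mul' _ _ ENNReal.ofReal_ne_top,
    ← lintegral_add_left' ((aemeasurable_trilinear hu hv hh).const_mul _)]
  refine lintegral_mono fun p => ?_
  obtain ⟨ξ, η⟩ := p
  by_cases hξ : ξ ∈ dyadicAnnulus j
  swap
  · simp [hsupp ξ hξ]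
  have hb := dyadicAnnulus_bounds hξ
  simp only
  have n1 : ‖ξ - η‖ ≤ ‖ξ‖ + ‖η‖ := norm_sub_le _ _
  have n3 : ‖ξ‖ ≤ ‖ξ - η‖ + ‖η‖ := by simpa using norm_add_le (ξ - η) η
  rcases lt_or_ge ‖η‖ ((2 : ℝ) ^ j / 4) with he | he
  · rw [indicator_of_mem (show ξ - η ∈ wideAnnulus j from ⟨by linarith, by linarith⟩),
      indicator_of_mem (show η ∈ Metric.ball (0 : Plane) (2 ^ j) by
        rw [mem_ball_zero_iff]; linarith)]
    refine le_add_of_nonneg_of_le zero_le ?_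
    gcongr
    exact hFu _
  · refine le_add_right ?_
    have hone : 1 ≤ ENNReal.ofReal (4 / 2 ^ j) * ENNReal.ofReal ‖η‖ := by
      rw [← ENNReal.ofReal_mul (by positivity), ENNReal.one_le_ofReal, div_mul_eq_mul_div,
        le_div_iff₀ h2]
      linarith
    calc _ ≤ u (ξ - η) * (ENNReal.ofReal (4 / 2 ^ j) * ENNReal.ofReal ‖η‖ * ‖G η‖ₑ) * h ξ := by
          gcongr
          · exact hFu _
          · exact le_mul_of_one_le_left zero_le hone
      _ ≤ u (ξ - η) * (ENNReal.ofReal (4 / 2 ^ j) * v η) * h ξ := by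
          rw [mul_assoc (ENNReal.ofReal (4 / 2 ^ j))]
          gcongr
          exact hGv η
      _ = _ := by ring

end

/-! ### Norms of densities -/

lemma enorm_ofReal_of_nonneg {x : ℝ} (hx : 0 ≤ x) : ‖(x : ℂ)‖ₑ = ENNReal.ofReal x := by
  rw [← ofReal_norm, Complex.norm_real, Real.norm_of_nonneg hx]

lemma homSobolev_eq {w : ℝ → ℝ} (hw : MemMW w) (σ : ℝ) (φ : Plane → ℂ) :
    homSobolev σ w φ = eLpNorm (weighted σ w (‖φ ·‖ₑ)) 2 volume := by
  rw [homSobolev, ← eLpNorm_enorm]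
  congr 1
  ext ξ
  have := hw.pos (norm_nonneg ξ)
  simp only [Pi.mul_apply, enorm_mul, lambdaSymbol, radialSymbol, weighted]
  rw [enorm_ofReal_of_nonneg (by positivity), enorm_ofReal_of_nonneg this.le,
    ENNReal.ofReal_mul (by positivity)]

lemma piNorm_eq {w w' : ℝ → ℝ} (hw : MemMW w) (hw' : MemMW w') {σ : ℝ} (hσ : σ ≤ 1) (τ : ℝ)
    (φ ψ : Plane → ℂ) :
    piNorm σ τ w w' φ ψ =
      lowNorm σ w (‖φ ·‖ₑ) * eLpNorm (weighted τ w' (‖ψ ·‖ₑ)) 2 volume := by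
  rw [piNorm, homSobolev_eq hw', lowNorm]
  congr 1
  split_ifs with h
  · exact homSobolev_eq hw σ φ
  · obtain rfl : σ = 1 := le_antisymm hσ (not_lt.1 h)
    rw [inhomSobolev, ← eLpNorm_enorm]
    congr 1
    ext ξ
    have := hw.pos (norm_nonneg ξ)
    simp only [Pi.mul_apply, enorm_mul, besselSymbol, radialSymbol]
    rw [enorm_ofReal_of_nonneg (by positivity), enorm_ofReal_of_nonneg this.le,
      ENNReal.ofReal_mul (by positivity)]

lemma ae_eq_zero_of_eLpNorm_mul_eq_zero {θ : Plane → ℝ} (hθ : Measurable θ)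
    (hpos : ∀ ξ, ξ ≠ 0 → 0 < θ ξ) {u : Plane → ℝ≥0∞} (hu : AEMeasurable u volume)
    (h0 : eLpNorm (fun ξ => ENNReal.ofReal (θ ξ) * u ξ) 2 volume = 0) : ∀ᵐ ξ : Plane, u ξ = 0 := by
  have hm : AEMeasurable (fun ξ => (ENNReal.ofReal (θ ξ) * u ξ) ^ 2) volume :=
    (hθ.ennreal_ofReal.aemeasurable.mul hu).pow_const 2
  have h1 := eLpNorm_two_sq (μ := volume) (fun ξ => ENNReal.ofReal (θ ξ) * u ξ)
  rw [h0, zero_pow two_ne_zero, eq_comm, lintegral_eq_zero_iff' hm] at h1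
  filter_upwards [h1, Measure.ae_ne volume (0 : Plane)] with ξ h2 hξ
  simp only [Pi.zero_apply, pow_eq_zero_iff two_ne_zero, mul_eq_zero, ENNReal.ofReal_eq_zero] at h2
  exact h2.resolve_left (not_le.2 (hpos ξ hξ))

lemma ae_eq_zero_of_eLpNorm_weighted_eq_zero {w : ℝ → ℝ} (hw : MemMW w) {σ : ℝ}
    {u : Plane → ℝ≥0∞} (hu : AEMeasurable u volume)
    (h0 : eLpNorm (weighted σ w u) 2 volume = 0) : ∀ᵐ ξ : Plane, u ξ = 0 :=
  ae_eq_zero_of_eLpNorm_mul_eq_zero ((measurable_norm.pow_const σ).mul hw.measurable_comp_norm)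
    (fun ξ hξ => mul_pos (Real.rpow_pos_of_pos (norm_pos_iff.2 hξ) σ) (hw.pos (norm_nonneg ξ))) hu h0

lemma ae_eq_zero_of_lowNorm_eq_zero {w : ℝ → ℝ} (hw : MemMW w) {σ : ℝ}
    {u : Plane → ℝ≥0∞} (hu : AEMeasurable u volume)
    (h0 : lowNorm σ w u = 0) : ∀ᵐ ξ : Plane, u ξ = 0 := by
  rw [lowNorm] at h0
  split_ifs at h0
  · exact ae_eq_zero_of_eLpNorm_weighted_eq_zero hw hu h0
  · refine ae_eq_zero_of_eLpNorm_mul_eq_zero (Measurable.mul (by fun_prop) hw.measurable_comp_norm)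
      (fun ξ _ => mul_pos (by positivity) (hw.pos (norm_nonneg ξ))) hu h0

/-- The dyadic tails of `u`, normalized by the norm of `u`. -/
lemma exists_tailNorm_eq {δ K : ℝ} (hK0 : 0 ≤ K)
    (hK : ∀ η, ∑' j : ℤ, tailWeight δ j η ^ 2 ≤ ENNReal.ofReal K)
    {u : Plane → ℝ≥0∞} (hu : AEMeasurable u volume) (h0 : eLpNorm u 2 volume ≠ 0)
    (htop : eLpNorm u 2 volume ≠ ∞) :
    ∃ x : ℤ → ℝ, (∀ j, 0 ≤ x j) ∧ Summable (fun j => x j ^ 2) ∧ ∑' j, x j ^ 2 ≤ K ∧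
      ∀ j, tailNorm δ j u = eLpNorm u 2 volume * ENNReal.ofReal (x j) := by
  set N := eLpNorm u 2 volume with hN
  set X : ℤ → ℝ≥0∞ := fun j => tailNorm δ j u / N with hX
  have hsum : ∑' j, X j ^ 2 ≤ ENNReal.ofReal K := by
    have h1 : ∀ j, X j ^ 2 = tailNorm δ j u ^ 2 * (N ^ 2)⁻¹ := fun j => by
      simp only [hX]
      rw [div_eq_mul_inv, mul_pow, ENNReal.inv_pow]
    simp only [h1]
    rw [ENNReal.tsum_mul_right, ← div_eq_mul_inv]
    exact ENNReal.div_le_of_le_mul (tsum_tailNorm_sq_le hK hu)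
  have hsum' : ∑' j, X j ^ 2 ≠ ∞ := ne_top_of_le_ne_top ENNReal.ofReal_ne_top hsum
  have hXt : ∀ j, X j ≠ ∞ := fun j h => by
    have := ENNReal.ne_top_of_tsum_ne_top hsum' j
    rw [h] at this
    simp at this
  have hsq : ∀ j, (X j).toReal ^ 2 = (X j ^ 2).toReal := fun j => (ENNReal.toReal_pow _ _).symm
  refine ⟨fun j => (X j).toReal, fun j => ENNReal.toReal_nonneg, ?_, ?_, fun j => ?_⟩
  · simp only [hsq]
    exact ENNReal.summable_toReal hsum'
  · simp only [hsq]
    rw [← ENNReal.tsum_toReal_eq fun j => ENNReal.pow_ne_top (hXt j)]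
    exact ENNReal.toReal_le_of_le_ofReal hK0 hsum
  · rw [ENNReal.ofReal_toReal (hXt j), hX, ENNReal.mul_div_cancel h0 htop]

/-! ### Assembly of the commutator estimate -/

lemma measurable_dyadicSymbol {p ν : ℝ → ℝ} {β : Plane → ℂ} (hp : Measurable fun ξ : Plane => p ‖ξ‖)
    (hν : Measurable fun ξ : Plane => ν ‖ξ‖) (hβ : Measurable β) (lam : ℝ) (j : ℤ) :
    Measurable (dyadicSymbol p ν β lam j) := by
  refine Measurable.mul (Complex.measurable_ofReal.comp (hp.mul (hν.const_mul lam).exp)) ?_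
  exact (hβ.comp (measurable_const_smul _)).const_mul _

lemma exists_norm_dyadicSymbol_le {p ν : ℝ → ℝ} {β : Plane → ℂ} {K B lam : ℝ}
    (hp : IsLogLipschitz K p) (hβ : IsBumpSymbol B β) (hmono : MonotoneOn ν (Ioi 0))
    (hlam : 0 ≤ lam) (j : ℤ) : ∃ M, ∀ ξ, ‖dyadicSymbol p ν β lam j ξ‖ ≤ M := by
  have h2 : (0 : ℝ) < 2 ^ j := by positivity
  have hp2 := hp.1 _ h2
  have hB : 0 ≤ B := (norm_nonneg _).trans (hβ.norm_le 0)
  refine ⟨4 ^ K * B * p (2 ^ j) * 2 ^ j * Real.exp (lam * ν (2 * 2 ^ j)), fun ξ => ?_⟩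
  by_cases hξ : ξ ∈ dyadicAnnulus j
  · refine (norm_dyadicSymbol_le (ν := ν) hp hβ lam j ξ).trans ?_
    gcongr
    exact hmono (norm_pos_of_mem_dyadicAnnulus hξ) (show (0 : ℝ) < 2 * 2 ^ j by positivity)
      (dyadicAnnulus_bounds hξ).2.le
  · rw [dyadicSymbol_eq_zero hβ hξ, norm_zero]
    positivity

/-- The norm of one interaction, expressed through the gauge `Γ` and the normalized tail `x`. -/
lemma ofReal_mul_interaction_le {a b D x : ℝ} {J A T N : ℝ≥0∞} (ha : 0 ≤ a) (hD : 0 ≤ D)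
    (hJ : ENNReal.ofReal (a / b) * J ≤ ENNReal.ofReal D) (hT : T = N * ENNReal.ofReal x)
    (hAN : A * N ≠ ∞) :
    ENNReal.ofReal a * (ENNReal.ofReal (1 / b) * J * (A * T)) ≤
      ENNReal.ofReal (D * (A * N).toReal * x) := by
  calc _ = ENNReal.ofReal (a / b) * J * (A * N) * ENNReal.ofReal x := by
        rw [hT, div_eq_mul_one_div a b, ENNReal.ofReal_mul ha]; ring
    _ ≤ ENNReal.ofReal D * ENNReal.ofReal (A * N).toReal * ENNReal.ofReal x := by
        rw [ENNReal.ofReal_toReal hAN]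
        gcongr
    _ = _ := by
        rw [ENNReal.ofReal_mul (by positivity), ENNReal.ofReal_mul hD]

/-- Three sequences with bounded `ℓ²` norms are dominated by one normalized sequence. -/
lemma exists_seq_dominating {K : ℝ} (hK : 0 < K) {x y z : ℤ → ℝ} (hx : ∀ j, 0 ≤ x j)
    (hy : ∀ j, 0 ≤ y j) (hz : ∀ j, 0 ≤ z j) (sx : Summable fun j => x j ^ 2)
    (sy : Summable fun j => y j ^ 2) (sz : Summable fun j => z j ^ 2)
    (tx : ∑' j, x j ^ 2 ≤ K) (ty : ∑' j, y j ^ 2 ≤ K) (tz : ∑' j, z j ^ 2 ≤ K) :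
    ∃ c : ℤ → ℝ, (∀ j, 0 ≤ c j) ∧ Summable (fun j => c j ^ 2) ∧ ∑' j, c j ^ 2 ≤ 1 ∧
      ∀ j, x j ≤ 3 * √K * c j ∧ y j ≤ 3 * √K * c j ∧ z j ≤ 3 * √K * c j := by
  have hs : 0 < √K := Real.sqrt_pos.2 hK
  have hsum := ((sx.add sy).add sz).mul_left (1 / (3 * K))
  have hle : ∀ j, ((x j + y j + z j) / (3 * √K)) ^ 2 ≤
      1 / (3 * K) * (x j ^ 2 + y j ^ 2 + z j ^ 2) := by
    intro j
    rw [div_pow, mul_pow, Real.sq_sqrt hK.le, one_div_mul_eq_div,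
      div_le_div_iff₀ (by positivity) (by positivity)]
    nlinarith [mul_nonneg hK.le (sq_nonneg (x j - y j)), mul_nonneg hK.le (sq_nonneg (x j - z j)),
      mul_nonneg hK.le (sq_nonneg (y j - z j))]
  have hsc := Summable.of_nonneg_of_le (fun j => sq_nonneg _) hle hsum
  refine ⟨fun j => (x j + y j + z j) / (3 * √K), fun j => ?_, hsc, ?_, fun j => ?_⟩
  · have := hx j; have := hy j; have := hz j
    positivity
  · refine (hsc.tsum_le_tsum hle hsum).trans ?_
    rw [tsum_mul_left, (sx.add sy).tsum_add sz, sx.tsum_add sy, one_div_mul_eq_div,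
      div_le_one (by positivity)]
    linarith
  · rw [mul_div_cancel₀ _ (by positivity)]
    have := hx j; have := hy j; have := hz j
    refine ⟨by linarith, by linarith, by linarith⟩

lemma norm_le_of_enorm_le_interactions {z : ℂ} {S a b D H τ₁ τ₂ τ₃ : ℝ} {t₁ t₂ t₃ : ℝ≥0∞}
    (hS : 0 ≤ S) (ha : 0 ≤ a) (hb : 0 ≤ b) (hD : 0 ≤ D) (hH : 0 ≤ H)
    (h1 : ENNReal.ofReal a * t₁ ≤ ENNReal.ofReal τ₁) (h2 : ENNReal.ofReal a * t₂ ≤ ENNReal.ofReal τ₂)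
    (h3 : ENNReal.ofReal a * t₃ ≤ ENNReal.ofReal τ₃) (p1 : 0 ≤ τ₁) (p2 : 0 ≤ τ₂) (p3 : 0 ≤ τ₃)
    (hz : ‖z‖ₑ ≤ ENNReal.ofReal (S * (a * b)) *
      (ENNReal.ofReal D * (t₁ + t₂ + t₃) * ENNReal.ofReal H)) :
    ‖z‖ ≤ S * b * D * (τ₁ + τ₂ + τ₃) * H := by
  rw [← ENNReal.ofReal_le_ofReal_iff (by positivity), ofReal_norm]
  refine hz.trans ?_
  calc _ = ENNReal.ofReal (S * b * D) * (ENNReal.ofReal a * t₁ + ENNReal.ofReal a * t₂ +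
          ENNReal.ofReal a * t₃) * ENNReal.ofReal H := by
        rw [ENNReal.ofReal_mul hS, ENNReal.ofReal_mul ha, ENNReal.ofReal_mul (by positivity),
          ENNReal.ofReal_mul hS]
        ring
    _ ≤ ENNReal.ofReal (S * b * D) * (ENNReal.ofReal τ₁ + ENNReal.ofReal τ₂ +
          ENNReal.ofReal τ₃) * ENNReal.ofReal H := by gcongr
    _ = _ := by
        rw [← ENNReal.ofReal_add p1 p2, ← ENNReal.ofReal_add (by positivity) p3,
          ← ENNReal.ofReal_mul (by positivity), ← ENNReal.ofReal_mul (by positivity)]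

lemma eLpNorm_indicator_fourier_le (h : Lp ℂ 2 (volume : Measure Plane)) (j : ℤ) :
    eLpNorm ((dyadicAnnulus j).indicator
      fun ξ => ‖(𝓕 h : Lp ℂ 2 (volume : Measure Plane)) ξ‖ₑ) 2 volume ≤ ENNReal.ofReal ‖h‖ := by
  refine (eLpNorm_mono_enorm (g := fun ξ => ‖(𝓕 h : Lp ℂ 2 (volume : Measure Plane)) ξ‖ₑ)
    fun ξ => ?_).trans_eq ?_
  · simp only [enorm_eq_self]
    exact indicator_le_self _ _ ξ
  · rw [eLpNorm_enorm, ← Lp.enorm_def, ← ofReal_norm, Lp.norm_fourier_eq]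

lemma trilinear_congr_right {u v h h' : Plane → ℝ≥0∞} (hh : h =ᵐ[volume] h') :
    trilinear u v h = trilinear u v h' := by
  refine lintegral_congr_ae ?_
  filter_upwards [hh] with ξ hξ
  rw [hξ]

lemma eLpNorm_indicator_one_dyadicAnnulus_ne_top (j : ℤ) :
    eLpNorm ((dyadicAnnulus j).indicator (1 : Plane → ℝ≥0∞)) 2 volume ≠ ∞ := by
  have hsub : dyadicAnnulus j ⊆ Metric.ball 0 (2 * 2 ^ j) := fun ξ hξ => by
    simpa using (dyadicAnnulus_bounds hξ).2
  have := eLpNorm_indicator_const (c := (1 : ℝ≥0∞)) (p := 2) (μ := (volume : Measure Plane))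
    (measurableSet_dyadicAnnulus j) two_ne_zero ENNReal.ofNat_ne_top
  change eLpNorm ((dyadicAnnulus j).indicator fun _ => (1 : ℝ≥0∞)) 2 volume ≠ ∞
  rw [this]
  refine ENNReal.mul_ne_top (by simp) (ENNReal.rpow_ne_top_of_nonneg (by norm_num) ?_)
  exact ne_top_of_le_ne_top measure_ball_lt_top.ne (measure_mono hsub)

theorem mainTheorem11
    (φ : 𝓢(Plane, ℝ)) (hφ : IsLittlewoodPaley φ)
    (r s s' : ℝ) (hs : s ≤ 1) (hs' : s' ≤ 1) (hss' : 0 < s + s')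
    (ω ω₁ ω₂ ω₃ ω₁' ω₂' ω₃' : ℝ → ℝ)
    (hω : MemMW ω) (hω₁ : MemMW ω₁) (hω₂ : MemMW ω₂) (hω₃ : MemMW ω₃)
    (hω₁' : MemMW ω₁') (hω₂' : MemMW ω₂') (hω₃' : MemMW ω₃')
    (Γ₁ Γ₂ Γ₃ : ℝ → ℝ)
    (hΓ₁ : ∀ y, 0 ≤ y → 0 ≤ Γ₁ y) (hΓ₂ : ∀ y, 0 ≤ y → 0 ≤ Γ₂ y) (hΓ₃ : ∀ y, 0 ≤ y → 0 ≤ Γ₃ y)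
    (hc₁ : LowHighCondition s ω ω₁ ω₁' Γ₁)
    (hc₂ : LowHighCondition s' ω ω₂ ω₂' Γ₂)
    (hc₃ : HighHighCondition ω ω₃ ω₃' Γ₃)
    (m ν : ℝ → ℝ) (hm : MemMD m) (hν : MemMS m ν) :
    ∃ c C : ℝ, 0 < c ∧ 0 < C ∧
      ∀ lam : ℝ, 0 ≤ lam →
      ∀ (f g : 𝓢'(Plane, ℂ)) (fHat gHat : Plane → ℂ),
        HasFourierDensity f fHat → HasFourierDensity g gHat →
      ∀ Ef ΛEg : Plane → ℂ,
        Ef = gevreySymbol lam ν * fHat →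
        ΛEg = lambdaSymbol 1 * gevreySymbol lam ν * gHat →
        piNorm s s' ω₁ ω₁' Ef ΛEg ≠ ∞ →
        piNorm s' s ω₂ ω₂' ΛEg Ef ≠ ∞ →
        rhoNorm s s' ω₃ ω₃' Ef ΛEg ≠ ∞ →
      ∃ cseq : ℤ → ℝ,
        (∀ j, 0 ≤ cseq j) ∧ Summable (fun j => cseq j ^ 2) ∧ ∑' j, cseq j ^ 2 ≤ 1 ∧
        ∀ (j : ℤ) (h : Lp ℂ 2 (volume : Measure Plane)), SpectrallyLocalized h j →
        ∀ a : Plane → ℂ,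
          ((∃ ℓ : Fin 2, a = radialSymbol ω * lambdaSymbol r * gevreySymbol lam ν *
              blockSymbol φ j * partialSymbol ℓ) ∨
            a = radialSymbol ω * lambdaSymbol (r + 1) * gevreySymbol lam ν * blockSymbol φ j) →
          CommutatorPairingExists a gHat fHat h ∧
          ‖fourierPairing (commutatorHat a gHat fHat) h‖ ≤
            C * (1 + lam) * Real.exp (c * lam) * cseq j * (2 : ℝ) ^ ((r - s - s' + 1) * (j : ℝ)) *
              (Γ₁ ((2 : ℝ) ^ j) * (piNorm s s' ω₁ ω₁' Ef ΛEg).toReal +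
                Γ₂ ((2 : ℝ) ^ j) * (piNorm s' s ω₂ ω₂' ΛEg Ef).toReal +
                Γ₃ ((2 : ℝ) ^ j) * (rhoNorm s s' ω₃ ω₃' Ef ΛEg).toReal) *
              ‖h‖ := by
  obtain ⟨B, hB, hsymb⟩ := hφ.exists_eq_dyadicSymbol
  obtain ⟨Kω, hKω⟩ := hω.isLogLipschitz
  obtain ⟨N, hN0, hmono, hN⟩ := hν.monotoneOn_and_abs_sub_le
  have hp := hKω.mul (IsLogLipschitz.rpow r)
  obtain ⟨c, Cs, hc, hCs, hdiff⟩ := norm_dyadicSymbol_sub_le hp hB hN0 hmono hν.nonneg hN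
  obtain ⟨Ct, hCt, htri⟩ := exists_trilinear_le hs hs' hss' hω₁ hω₂ hω₃ hω₁' hω₂' hω₃'
  have hδ : 0 < (s + s') / 2 := by linarith
  obtain ⟨K, hK, hKtail⟩ := exists_tsum_tailWeight_sq_le hδ
  obtain ⟨C₁, hC₁, hcb₁⟩ := hc₁
  obtain ⟨C₂, hC₂, hcb₂⟩ := hc₂
  obtain ⟨C₃, hC₃, hcb₃⟩ := hc₃
  obtain ⟨K₂, hK₂⟩ := hω₂'.isLogLipschitz
  obtain ⟨Cw, -, hwide⟩ := exists_eLpNorm_indicator_wideAnnulus_le hK₂ s hδ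
  have hsK : 0 < √K := Real.sqrt_pos.2 hK
  refine ⟨c, Cs * Ct * (C₁ + C₂ + C₃) * (3 * √K), hc, by positivity, ?_⟩
  intro lam hlam f g F G hf hg Ef ΛEg hEf hΛEg hπ₁ hπ₂ hρ
  have hFm := hf.1.aestronglyMeasurable
  have hGm := hg.1.aestronglyMeasurable
  have hνm : Measurable fun ξ : Plane => ν ‖ξ‖ :=
    (hν.contDiffOn.continuousOn.comp_continuous continuous_norm fun ξ => norm_nonneg ξ).measurable
  set u : Plane → ℝ≥0∞ := (‖Ef ·‖ₑ) with hu
  set v : Plane → ℝ≥0∞ := (‖ΛEg ·‖ₑ) with hv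
  have hu_eq : ∀ ξ, u ξ = ENNReal.ofReal (Real.exp (lam * ν ‖ξ‖)) * ‖F ξ‖ₑ := fun ξ => by
    simp only [hu, hEf, Pi.mul_apply, enorm_mul, gevreySymbol]
    rw [enorm_ofReal_of_nonneg (Real.exp_pos _).le]
  have hv_eq : ∀ ξ, v ξ = ENNReal.ofReal (‖ξ‖ * Real.exp (lam * ν ‖ξ‖)) * ‖G ξ‖ₑ := fun ξ => by
    simp only [hv, hΛEg, Pi.mul_apply, enorm_mul, gevreySymbol, lambdaSymbol, Real.rpow_one]
    rw [enorm_ofReal_of_nonneg (Real.exp_pos _).le, enorm_ofReal_of_nonneg (norm_nonneg _),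
      ENNReal.ofReal_mul (norm_nonneg _)]
  have hum : AEMeasurable u volume := by
    rw [show u = _ from funext hu_eq]
    exact ((hνm.const_mul lam).exp.ennreal_ofReal.aemeasurable).mul hFm.enorm
  have hvm : AEMeasurable v volume := by
    rw [show v = _ from funext hv_eq]
    exact ((measurable_norm.mul (hνm.const_mul lam).exp).ennreal_ofReal.aemeasurable).mul hGm.enorm
  have hexp : ∀ ξ : Plane, 1 ≤ Real.exp (lam * ν ‖ξ‖) := fun ξ =>
    Real.one_le_exp (mul_nonneg hlam (hν.nonneg _ (norm_nonneg _)))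
  have hFu : ∀ ζ, ‖F ζ‖ₑ ≤ u ζ := fun ζ => by
    rw [hu_eq]
    exact le_mul_of_one_le_left zero_le (ENNReal.one_le_ofReal.2 (hexp ζ))
  have hGv : ∀ η, ENNReal.ofReal ‖η‖ * ‖G η‖ₑ ≤ v η := fun η => by
    rw [hv_eq]
    gcongr
    exact le_mul_of_one_le_right (norm_nonneg _) (hexp η)
  -- reduction of the claim for one test function to the finiteness of the trilinear form
  have core : (∀ (j : ℤ) (h : Plane → ℝ≥0∞), AEMeasurable h volume →
      (∀ ξ, ξ ∉ dyadicAnnulus j → h ξ = 0) → eLpNorm h 2 volume ≠ ∞ →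
      trilinear (‖F ·‖ₑ) (‖G ·‖ₑ) h ≠ ∞) →
      ∀ (j : ℤ) (h : Lp ℂ 2 (volume : Measure Plane)), SpectrallyLocalized h j →
      ∀ a : Plane → ℂ,
        ((∃ ℓ : Fin 2, a = radialSymbol ω * lambdaSymbol r * gevreySymbol lam ν *
            blockSymbol φ j * partialSymbol ℓ) ∨
          a = radialSymbol ω * lambdaSymbol (r + 1) * gevreySymbol lam ν * blockSymbol φ j) →
        CommutatorPairingExists a G F h ∧
        ‖fourierPairing (commutatorHat a G F) h‖ₑ ≤
          ENNReal.ofReal (Cs * (1 + lam) * Real.exp (c * lam) *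
            (ω (2 ^ j) * ((2 : ℝ) ^ j) ^ r)) * trilinear u v ((dyadicAnnulus j).indicator
              fun ξ => ‖(𝓕 h : Lp ℂ 2 (volume : Measure Plane)) ξ‖ₑ) := by
    intro hfin j h hloc a ha
    obtain ⟨β, hβm, hβ, rfl⟩ := hsymb ω ν r lam j a ha
    obtain ⟨M, hM⟩ := exists_norm_dyadicSymbol_le hp hβ hmono hlam j
    have ham := measurable_dyadicSymbol (p := fun t => ω t * t ^ r)
      (hω.measurable_comp_norm.mul (measurable_norm.pow_const r)) hνm hβm lam j
    have hHm := (Lp.aestronglyMeasurable (𝓕 h : Lp ℂ 2 (volume : Measure Plane))).enorm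
    have hHae : (fun ξ => ‖(𝓕 h : Lp ℂ 2 (volume : Measure Plane)) ξ‖ₑ) =ᵐ[volume]
        (dyadicAnnulus j).indicator
          fun ξ => ‖(𝓕 h : Lp ℂ 2 (volume : Measure Plane)) ξ‖ₑ := by
      filter_upwards [hloc] with ξ hξ
      by_cases hmem : ξ ∈ dyadicAnnulus j
      · rw [indicator_of_mem hmem]
      · rw [indicator_of_notMem hmem, hξ hmem, enorm_zero]
    have hex := commutatorPairingExists_of_trilinear (h := h) hFm hGm ham.aestronglyMeasurable hM
      (fun k => hfin k _ (aemeasurable_one.indicator (measurableSet_dyadicAnnulus k))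
        (fun ξ hξ => indicator_of_notMem hξ _) (eLpNorm_indicator_one_dyadicAnnulus_ne_top k))
      (by
        rw [trilinear_congr_right hHae]
        exact hfin j _ (hHm.indicator (measurableSet_dyadicAnnulus j))
          (fun ξ hξ => indicator_of_notMem hξ _)
          (ne_top_of_le_ne_top ENNReal.ofReal_ne_top (eLpNorm_indicator_fourier_le h j)))
    refine ⟨hex, enorm_fourierPairing_commutatorHat_le hloc hex ENNReal.ofReal_ne_top ?_⟩
    intro ξ η hξ
    have hd := hdiff β hβ lam hlam j ξ (ξ - η) η hξ (by abel)
    have hωj := hω.pos (y := 2 ^ j) (by positivity)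
    rw [hu_eq, hv_eq]
    calc _ ≤ ENNReal.ofReal (Cs * (1 + lam) * Real.exp (c * lam) *
            (ω (2 ^ j) * ((2 : ℝ) ^ j) ^ r) *
            (Real.exp (lam * ν ‖ξ - η‖) * (‖η‖ * Real.exp (lam * ν ‖η‖)))) *
            (‖F (ξ - η)‖ₑ * ‖G η‖ₑ) := by
          gcongr
          rw [← ofReal_norm]
          exact ENNReal.ofReal_le_ofReal hd
      _ = _ := by
          rw [ENNReal.ofReal_mul (by positivity), ENNReal.ofReal_mul (Real.exp_pos _).le]
          ring
  by_cases hdeg : (∀ᵐ ξ : Plane, u ξ = 0) ∨ ∀ᵐ ξ : Plane, v ξ = 0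
  · -- one of the two factors vanishes, hence so does everything
    have hdeg' : (∀ᵐ ξ : Plane, ‖F ξ‖ₑ = 0) ∨ ∀ᵐ ξ : Plane, ‖G ξ‖ₑ = 0 := by
      rcases hdeg with h0 | h0
      · left
        filter_upwards [h0] with ξ hξ
        exact le_antisymm ((hFu ξ).trans_eq hξ) zero_le
      · right
        filter_upwards [h0, Measure.ae_ne volume (0 : Plane)] with ξ hξ hne
        have := (hGv ξ).trans_eq hξ
        rw [nonpos_iff_eq_zero, mul_eq_zero, ENNReal.ofReal_eq_zero] at this
        exact this.resolve_left (not_le.2 (norm_pos_iff.2 hne))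
    refine ⟨fun _ => 0, fun _ => le_rfl, by simp, by simp, ?_⟩
    intro j h hloc a ha
    obtain ⟨hex, hle⟩ := core (fun j h _ _ _ => by
      rw [trilinear_eq_zero_of_ae_eq_zero hdeg']; exact ENNReal.zero_ne_top) j h hloc a ha
    refine ⟨hex, ?_⟩
    rw [trilinear_eq_zero_of_ae_eq_zero hdeg, mul_zero, nonpos_iff_eq_zero, enorm_eq_zero] at hle
    rw [hle]
    simp
  -- otherwise all the norms are positive, hence finite
  rw [not_or] at hdeg
  have hπ₁e := piNorm_eq hω₁ hω₁' hs s' Ef ΛEg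
  have hπ₂e := piNorm_eq hω₂ hω₂' hs' s ΛEg Ef
  have hρe : rhoNorm s s' ω₃ ω₃' Ef ΛEg =
      eLpNorm (weighted s ω₃ u) 2 volume * eLpNorm (weighted s' ω₃' v) 2 volume := by
    rw [rhoNorm, homSobolev_eq hω₃, homSobolev_eq hω₃']
  rw [← hu, ← hv] at hπ₁e hπ₂e
  rw [hπ₁e, hπ₂e, hρe]
  rw [hπ₁e] at hπ₁
  rw [hπ₂e] at hπ₂
  rw [hρe] at hρ
  have nA₁ : lowNorm s ω₁ u ≠ 0 := fun h0 => hdeg.1 (ae_eq_zero_of_lowNorm_eq_zero hω₁ hum h0)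
  have nA₂ : lowNorm s' ω₂ v ≠ 0 := fun h0 => hdeg.2 (ae_eq_zero_of_lowNorm_eq_zero hω₂ hvm h0)
  have nA₃ : eLpNorm (weighted s ω₃ u) 2 volume ≠ 0 := fun h0 =>
    hdeg.1 (ae_eq_zero_of_eLpNorm_weighted_eq_zero hω₃ hum h0)
  have nB₁ : eLpNorm (weighted s' ω₁' v) 2 volume ≠ 0 := fun h0 =>
    hdeg.2 (ae_eq_zero_of_eLpNorm_weighted_eq_zero hω₁' hvm h0)
  have nB₂ : eLpNorm (weighted s ω₂' u) 2 volume ≠ 0 := fun h0 =>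
    hdeg.1 (ae_eq_zero_of_eLpNorm_weighted_eq_zero hω₂' hum h0)
  have nB₃ : eLpNorm (weighted s' ω₃' v) 2 volume ≠ 0 := fun h0 =>
    hdeg.2 (ae_eq_zero_of_eLpNorm_weighted_eq_zero hω₃' hvm h0)
  have fin : ∀ {A N : ℝ≥0∞}, A * N ≠ ∞ → A ≠ 0 → N ≠ ∞ := fun h hA hN => h (by
    rw [hN, ENNReal.mul_top hA])
  obtain ⟨x₁, x₁0, x₁s, x₁K, hx₁⟩ := exists_tailNorm_eq hK.le hKtail
    (aemeasurable_weighted hω₁' s' hvm) nB₁ (fin hπ₁ nA₁)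
  obtain ⟨x₂, x₂0, x₂s, x₂K, hx₂⟩ := exists_tailNorm_eq hK.le hKtail
    (aemeasurable_weighted hω₂' s hum) nB₂ (fin hπ₂ nA₂)
  obtain ⟨x₃, x₃0, x₃s, x₃K, hx₃⟩ := exists_tailNorm_eq hK.le hKtail
    (aemeasurable_weighted hω₃' s' hvm) nB₃ (fin hρ nA₃)
  obtain ⟨cseq, hc0, hcs, hc1, hcx⟩ :=
    exists_seq_dominating hK x₁0 x₂0 x₃0 x₁s x₂s x₃s x₁K x₂K x₃K
  have hterm : ∀ j : ℤ,
      ENNReal.ofReal (ω (2 ^ j)) * (ENNReal.ofReal (1 / ω₁' (2 ^ j)) *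
        lowFreqIntegral s ω₁ (2 ^ j) ^ (1 / 2 : ℝ) *
          (lowNorm s ω₁ u * tailNorm ((s + s') / 2) j (weighted s' ω₁' v))) ≤
        ENNReal.ofReal (C₁ * Γ₁ (2 ^ j) *
          (lowNorm s ω₁ u * eLpNorm (weighted s' ω₁' v) 2 volume).toReal * x₁ j) ∧
      ENNReal.ofReal (ω (2 ^ j)) * (ENNReal.ofReal (1 / ω₂' (2 ^ j)) *
        lowFreqIntegral s' ω₂ (2 ^ j) ^ (1 / 2 : ℝ) *
          (lowNorm s' ω₂ v * tailNorm ((s + s') / 2) j (weighted s ω₂' u))) ≤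
        ENNReal.ofReal (C₂ * Γ₂ (2 ^ j) *
          (lowNorm s' ω₂ v * eLpNorm (weighted s ω₂' u) 2 volume).toReal * x₂ j) ∧
      ENNReal.ofReal (ω (2 ^ j)) * (ENNReal.ofReal (1 / (ω₃ (2 ^ j) * ω₃' (2 ^ j))) *
          (eLpNorm (weighted s ω₃ u) 2 volume *
            tailNorm ((s + s') / 2) j (weighted s' ω₃' v))) ≤
        ENNReal.ofReal (C₃ * Γ₃ (2 ^ j) *
          (eLpNorm (weighted s ω₃ u) 2 volume *
            eLpNorm (weighted s' ω₃' v) 2 volume).toReal * x₃ j) := by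
    intro j
    have h2 : (0 : ℝ) ≤ 2 ^ j := by positivity
    have hωj := (hω.pos h2).le
    refine ⟨ofReal_mul_interaction_le hωj (mul_nonneg hC₁.le (hΓ₁ _ h2)) (hcb₁ _ h2) (hx₁ j) hπ₁,
      ofReal_mul_interaction_le hωj (mul_nonneg hC₂.le (hΓ₂ _ h2)) (hcb₂ _ h2) (hx₂ j) hπ₂, ?_⟩
    have := ofReal_mul_interaction_le (J := 1) hωj (mul_nonneg hC₃.le (hΓ₃ _ h2))
      (by rw [mul_one]; exact ENNReal.ofReal_le_ofReal (hcb₃ _ h2)) (hx₃ j) hρ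
    rwa [mul_one] at this
  refine ⟨cseq, hc0, hcs, hc1, ?_⟩
  intro j h hloc a ha
  have hfin : ∀ (j : ℤ) (h : Plane → ℝ≥0∞), AEMeasurable h volume →
      (∀ ξ, ξ ∉ dyadicAnnulus j → h ξ = 0) → eLpNorm h 2 volume ≠ ∞ →
      trilinear (‖F ·‖ₑ) (‖G ·‖ₑ) h ≠ ∞ := by
    intro j h hh hsupp hh2
    have hωj := hω.pos (y := 2 ^ j) (by positivity)
    have hωj0 : ENNReal.ofReal (ω (2 ^ j)) ≠ 0 := by
      rw [Ne, ENNReal.ofReal_eq_zero, not_le]; exact hωj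
    have ht := hterm j
    refine trilinear_ne_top_of_locallyIntegrable hFm hg.1 hum hvm hh hsupp hFu hGv ?_ ?_ hh2
    · refine ne_top_of_le_ne_top ?_ (htri j u v h hum hvm hh hsupp)
      refine ENNReal.mul_ne_top (ENNReal.mul_ne_top ENNReal.ofReal_ne_top ?_) hh2
      exact ENNReal.add_ne_top.2 ⟨ENNReal.add_ne_top.2
        ⟨fin (ne_top_of_le_ne_top ENNReal.ofReal_ne_top ht.1) hωj0,
        fin (ne_top_of_le_ne_top ENNReal.ofReal_ne_top ht.2.1) hωj0⟩,
        fin (ne_top_of_le_ne_top ENNReal.ofReal_ne_top ht.2.2) hωj0⟩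
    · refine ne_top_of_le_ne_top (ENNReal.mul_ne_top ENNReal.ofReal_ne_top ?_) (hwide j u)
      rw [hx₂ j]
      exact ENNReal.mul_ne_top (fin hπ₂ nA₂) ENNReal.ofReal_ne_top
  obtain ⟨hex, hle⟩ := core hfin j h hloc a ha
  refine ⟨hex, ?_⟩
  have h2 : (0 : ℝ) < 2 ^ j := by positivity
  have hωj := hω.pos h2.le
  have hHm := (Lp.aestronglyMeasurable (𝓕 h : Lp ℂ 2 (volume : Measure Plane))).enorm
  have ht := hterm j
  have hΓ₁j := hΓ₁ _ h2.le
  have hΓ₂j := hΓ₂ _ h2.le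
  have hΓ₃j := hΓ₃ _ h2.le
  have hx₁j := x₁0 j
  have hx₂j := x₂0 j
  have hx₃j := x₃0 j
  have hcj := hc0 j
  obtain ⟨d₁, d₂, d₃⟩ := hcx j
  have hbound := norm_le_of_enorm_le_interactions (S := Cs * (1 + lam) * Real.exp (c * lam))
    (a := ω (2 ^ j)) (b := ((2 : ℝ) ^ j) ^ r) (D := Ct * ((2 : ℝ) ^ j) ^ (1 - s - s')) (H := ‖h‖)
    (by positivity) hωj.le (by positivity) (by positivity) (norm_nonneg h) ht.1 ht.2.1 ht.2.2
    (by positivity) (by positivity) (by positivity)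
    (hle.trans (by
      gcongr
      refine (htri j u v _ hum hvm (hHm.indicator (measurableSet_dyadicAnnulus j))
        (fun ξ hξ => indicator_of_notMem hξ _)).trans ?_
      gcongr
      exact eLpNorm_indicator_fourier_le h j))
  refine hbound.trans ?_
  set P₁ := (lowNorm s ω₁ u * eLpNorm (weighted s' ω₁' v) 2 volume).toReal
  set P₂ := (lowNorm s' ω₂ v * eLpNorm (weighted s ω₂' u) 2 volume).toReal
  set P₃ := (eLpNorm (weighted s ω₃ u) 2 volume * eLpNorm (weighted s' ω₃' v) 2 volume).toReal
  have hP₁ : 0 ≤ P₁ := ENNReal.toReal_nonneg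
  have hP₂ : 0 ≤ P₂ := ENNReal.toReal_nonneg
  have hP₃ : 0 ≤ P₃ := ENNReal.toReal_nonneg
  have hpow : (2 : ℝ) ^ ((r - s - s' + 1) * (j : ℝ)) =
      ((2 : ℝ) ^ j) ^ r * ((2 : ℝ) ^ j) ^ (1 - s - s') := by
    rw [← Real.rpow_add h2, ← Real.rpow_intCast, ← Real.rpow_mul two_pos.le]
    congr 1; ring
  rw [hpow]
  set Y := 3 * √K * cseq j with hY
  have hY0 : 0 ≤ Y := by positivity
  calc _ ≤ Cs * (1 + lam) * Real.exp (c * lam) * ((2 : ℝ) ^ j) ^ r *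
        (Ct * ((2 : ℝ) ^ j) ^ (1 - s - s')) *
        ((C₁ + C₂ + C₃) * Γ₁ (2 ^ j) * P₁ * Y + (C₁ + C₂ + C₃) * Γ₂ (2 ^ j) * P₂ * Y +
          (C₁ + C₂ + C₃) * Γ₃ (2 ^ j) * P₃ * Y) * ‖h‖ := by
        gcongr <;> linarith
    _ = _ := by rw [hY]; ring
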